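/- Let $g \ge 2$ and let $\Sigma_g$ be the fundamental group of a closed Riemann surface of genus $g$. Up to homeomorphism, such a surface is the space obtained from the closed unit disc, with its boundary circle divided into $4g$ arcs of equal length, by gluing the arcs in pairs according to the boundary word $a_1 b_1 a_1^{-1} b_1^{-1} \cdots a_g b_g a_g^{-1} b_g^{-1}$; the base point is arbitrary. Let $p \ge 5$ be a prime. Then for every field $K$ of characteristic $p$ whose transcendence degree $r$ over $\mathbb{F}_p$ satisfies $r \ge 2$ ($r$ may be infinite), there exists an integer $n$ such that $\mathrm{GL}_n(K)$ contains a subgroup isomorphic to $\Sigma_g$. -/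

import Mathlib

noncomputable section

/-- The point of the closed unit disc of `ℂ` at position `s` along the boundary circle, where the
circle is divided into `4 * g` arcs of equal length and the `k`-th arc is traversed
counterclockwise as `s` runs from `k` to `k + 1`. -/
def boundaryPoint (g : ℕ) (s : ℝ) : Metric.closedBall (0 : ℂ) 1 :=
  ⟨Complex.exp ((2 * Real.pi * s / (4 * g) : ℝ) * Complex.I), by
    rw [mem_closedBall_zero_iff, Complex.norm_exp_ofReal_mul_I]⟩

/-- The side identifications of the `4 * g`-gon with boundary word
`a₁ b₁ a₁⁻¹ b₁⁻¹ ⋯ a_g b_g a_g⁻¹ b_g⁻¹`: for every `j < g`, arc `4 * j` is glued to arc `4 * j + 2`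
and arc `4 * j + 1` is glued to arc `4 * j + 3`, in both cases reversing the direction. -/
inductive SideGluing (g : ℕ) :
    Metric.closedBall (0 : ℂ) 1 → Metric.closedBall (0 : ℂ) 1 → Prop
  | a (j : Fin g) (t : unitInterval) :
      SideGluing g (boundaryPoint g (4 * (j : ℕ) + t)) (boundaryPoint g (4 * (j : ℕ) + 3 - t))
  | b (j : Fin g) (t : unitInterval) :
      SideGluing g (boundaryPoint g (4 * (j : ℕ) + 1 + t)) (boundaryPoint g (4 * (j : ℕ) + 4 - t))

/-- The standard closed orientable surface of genus `g ≥ 1`: the closed disc, regarded as a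
`4 * g`-gon, modulo the equivalence relation generated by the side identifications. -/
def StandardSurface (g : ℕ) : Type := Quot (SideGluing g)

/-- The quotient topology. -/
instance (g : ℕ) : TopologicalSpace (StandardSurface g) :=
  inferInstanceAs (TopologicalSpace (Quot (SideGluing g)))

/-- `X` is (the underlying topological space of) a closed orientable surface of genus `g`, for
`g ≥ 1`. -/
def IsClosedSurfaceOfGenus (g : ℕ) (X : Type*) [TopologicalSpace X] : Prop :=
  Nonempty (X ≃ₜ StandardSurface g)

end

/-! Already `n = 2` works. The group `FreeDouble`, two copies of the free group of rank two
amalgamated along the commutator `c` of the generators, is the genus two surface group. A surface of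
genus `n + 2` is a cyclic cover of degree `n + 1` of the genus two surface, so every `SurfaceGroup
g` with `2 ≤ g` embeds in `FreeDouble` (`exists_surfaceGroup_injective_freeDouble`).

It remains to represent `FreeDouble` faithfully over a rational function field in two variables over
`ZMod p`, which embeds in `K` because the transcendence degree is at least two. Over `L = RatFunc
(ZMod p)` a Schottky group gives a faithful `ρ` of the free group; its parameter is chosen so that
`ρ c` has its eigenvalues in `L`, and a conjugation makes `ρ c` diagonal. If an off-diagonal entry
of `ρ f` vanishes, then `ρ f` is triangular, its commutator with `ρ c` is unipotent and so has order
dividing `p`. Free groups are torsion-free, so `f` commutes with `c` and is a power of `c`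
(`mem_zpowers_of_corner_eq_zero`). Thus every `f` outside the amalgamated subgroup has both
off-diagonal entries nonzero. Conjugating the second copy by `diag (X, 1)`, with a new variable `X`,
fixes the diagonal matrices, and a ping-pong argument for the degree in `X` shows that the
representation of the double is faithful (`doubleRep_injective`).

The fundamental group of the glued polygon is identified with `SurfaceGroup g` without van Kampen's
theorem. Crossing the arcs gives loops that satisfy the surface relation. They generate, since paths
can be cut into pieces lying in charts that deform to discrete sets
(`IsGluing.eq_top_of_forall_gluingLoop_mem`). There are no further relations, since a cocycle with
values in `SurfaceGroup g` defines a covering whose monodromy recovers left translation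
(`IsGluing.exists_monodromy`). -/

section

/-! ### Ping-pong for the double of a linear group over a valued field. -/

open Matrix

/-- The invertible diagonal matrix `diag (s, 1)`. -/
def diagOne {M : Type*} [Field M] (s : M) (hs : s ≠ 0) : GL (Fin 2) M where
  val := !![s, 0; 0, 1]
  inv := !![s⁻¹, 0; 0, 1]
  val_inv := by ext i j; fin_cases i <;> fin_cases j <;> simp [hs]
  inv_val := by ext i j; fin_cases i <;> fin_cases j <;> simp [hs]

section Valuation

variable {M Γ : Type*} [Field M] [LinearOrderedCommGroupWithZero Γ] (v : Valuation M Γ)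

/-- A lower corner entry of maximal valuation moves vectors with dominant first coordinate to
vectors with dominant second coordinate. -/
theorem ping_zero {A : Matrix (Fin 2) (Fin 2) M} (hA : ∀ i j, v (A i j) ≤ 1)
    (h : v (A 1 0) = 1) {u : Fin 2 → M} (hu : v (u 1) < v (u 0)) :
    v ((A *ᵥ u) 0) ≤ v ((A *ᵥ u) 1) ∧ v ((A *ᵥ u) 1) = v (u 0) := by
  have h1 : v ((A *ᵥ u) 1) = v (u 0) := by
    simp only [mulVec, dotProduct, Fin.sum_univ_two]
    rw [Valuation.map_add_eq_of_lt_left]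
    · simp [h]
    · simp only [map_mul, h, one_mul]
      exact lt_of_le_of_lt (mul_le_of_le_one_left' (hA 1 1)) hu
  refine ⟨?_, h1⟩
  rw [h1]
  simp only [mulVec, dotProduct, Fin.sum_univ_two]
  refine v.map_add_le ?_ ?_ <;> rw [map_mul]
  · exact mul_le_of_le_one_left' (hA 0 0)
  · exact (mul_le_of_le_one_left' (hA 0 1)).trans hu.le

/-- An upper corner entry of maximal valuation, after conjugation by `diag (s, 1)`, moves vectors
with dominant second coordinate to vectors with dominant first coordinate. -/
theorem ping_one {s : M} (hs : 1 < v s) {A B : Matrix (Fin 2) (Fin 2) M}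
    (hA : ∀ i j, v (A i j) ≤ 1)
    (h : v (A 0 1) = 1) (hB : B = !![A 0 0, s * A 0 1; s⁻¹ * A 1 0, A 1 1])
    {u : Fin 2 → M} (hu : v (u 0) ≤ v (u 1)) (hu1 : 1 ≤ v (u 1)) :
    v ((B *ᵥ u) 1) < v ((B *ᵥ u) 0) ∧ v s ≤ v ((B *ᵥ u) 0) := by
  have h0 : 0 < v (u 1) := zero_lt_one.trans_le hu1
  have hlt : v (u 1) < v s * v (u 1) := lt_mul_of_one_lt_left h0 hs
  have h1 : v ((B *ᵥ u) 0) = v s * v (u 1) := by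
    simp only [hB, mulVec, dotProduct, Fin.sum_univ_two]
    rw [Valuation.map_add_eq_of_lt_right]
    · simp [h]
    · simp only [of_apply, cons_val', cons_val_zero, cons_val_one, map_mul, h, mul_one]
      exact lt_of_le_of_lt ((mul_le_of_le_one_left' (hA 0 0)).trans hu) hlt
  rw [h1]
  refine ⟨lt_of_le_of_lt ?_ hlt, le_mul_of_one_le_right' hu1⟩
  simp only [hB, mulVec, dotProduct, Fin.sum_univ_two]
  refine v.map_add_le ?_ ?_ 
  · simp only [of_apply, cons_val', cons_val_zero, cons_val_one, map_mul, map_inv₀]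
    refine (mul_le_of_le_one_left' (mul_le_one' ?_ (hA 1 0))).trans hu
    exact inv_le_one_of_one_le₀ hs.le
  · simp only [of_apply, cons_val', cons_val_zero, cons_val_one, map_mul]
    exact mul_le_of_le_one_left' (hA 1 1)

end Valuation

section Double

variable {M Γ F : Type*} [Field M] [LinearOrderedCommGroupWithZero Γ] [Group F] (C : Subgroup F)

/-- The amalgamated product of two copies of `F` along the subgroup `C`. -/
abbrev DoubleGroup : Type _ := Monoid.PushoutI (fun _ : Fin 2 => C.subtype)

/-- The representation of the double of `F` along `C` which is `ρ` on the first copy and `ρ`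
conjugated by `D`, commuting with `ρ C`, on the second. -/
def doubleRep {Q : Type*} [Group Q] (ρ : F →* Q) (D : Q)
    (hD : ∀ c ∈ C, D * ρ c * D⁻¹ = ρ c) : DoubleGroup C →* Q :=
  Monoid.PushoutI.lift (fun i => if i = 0 then ρ else (MulAut.conj D).toMonoidHom.comp ρ)
    (ρ.comp C.subtype) (by
      intro i
      split_ifs
      · rfl
      · ext c; simpa using hD c c.2)

variable {C}

/-- Letters of the first copy outside `C` carry a dominant first coordinate to a dominant second one
without changing its size. Letters of the second copy carry it back and enlarge it by the factor `v
s`. The subgroup `C` acts by diagonal units, so a word containing a letter of the second copy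
outside `C` makes some integral vector non-integral. -/
theorem doubleRep_injective (v : Valuation M Γ) (ρ : F →* GL (Fin 2) M)
    (hρ : Function.Injective ρ) (hint : ∀ f i j, v ((ρ f).1 i j) ≤ 1)
    (hup : ∀ f ∉ C, v ((ρ f).1 0 1) = 1)
    (hlow : ∀ f ∉ C, v ((ρ f).1 1 0) = 1)
    (hC01 : ∀ c ∈ C, (ρ c).1 0 1 = 0)
    (hC10 : ∀ c ∈ C, (ρ c).1 1 0 = 0)
    (hC0 : ∀ c ∈ C, v ((ρ c).1 0 0) = 1)
    (hC1 : ∀ c ∈ C, v ((ρ c).1 1 1) = 1)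
    {s : M} (hs : s ≠ 0) (hvs : 1 < v s)
    (hD : ∀ c ∈ C, diagOne s hs * ρ c * (diagOne s hs)⁻¹ = ρ c) :
    Function.Injective (doubleRep C ρ (diagOne s hs) hD) := by
  classical
  set R := doubleRep C ρ (diagOne s hs) hD with hR
  have hR0 (f : F) : R (Monoid.PushoutI.of (0 : Fin 2) f) = ρ f := by
    simp [hR, doubleRep]
  have hR1 (f : F) : (R (Monoid.PushoutI.of (1 : Fin 2) f)).1 =
      !![(ρ f).1 0 0, s * (ρ f).1 0 1; s⁻¹ * (ρ f).1 1 0, (ρ f).1 1 1] := by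
    have : R (Monoid.PushoutI.of (1 : Fin 2) f) = diagOne s hs * ρ f * (diagOne s hs)⁻¹ := by
      simp [hR, doubleRep]
    have hinv : ((diagOne s hs)⁻¹).1 = !![s⁻¹, 0; 0, 1] := rfl
    rw [this, Units.val_mul, Units.val_mul, hinv]
    ext i j
    fin_cases i <;> fin_cases j <;>
      simp [diagOne, Matrix.mul_apply, Matrix.vecMul, dotProduct, Fin.sum_univ_two, mul_comm, hs]
  have hRb (c : C) : R (Monoid.PushoutI.base _ c) = ρ c := by simp [hR, doubleRep]
  have hRmul (x y : DoubleGroup C) (u : Fin 2 → M) :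
      (R (x * y)).1 *ᵥ u = (R x).1 *ᵥ ((R y).1 *ᵥ u) := by
    rw [map_mul, Units.val_mul, Matrix.mulVec_mulVec]
  have hbase (c : C) (u : Fin 2 → M) (i : Fin 2) :
      v (((R (Monoid.PushoutI.base _ c)).1 *ᵥ u) i) = v (u i) := by
    rw [hRb]
    fin_cases i <;>
      simp [mulVec, dotProduct, Fin.sum_univ_two, hC01 c c.2, hC10 c c.2, hC0 c c.2, hC1 c c.2]
  let B0 (x : DoubleGroup C) : Prop := ∃ u : Fin 2 → M, (∀ i, v (u i) ≤ 1) ∧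
    v (((R x).1 *ᵥ u) 0) ≤ v (((R x).1 *ᵥ u) 1) ∧ v s ≤ v (((R x).1 *ᵥ u) 1)
  let B1 (x : DoubleGroup C) : Prop := ∃ u : Fin 2 → M, (∀ i, v (u i) ≤ 1) ∧
    v (((R x).1 *ᵥ u) 1) < v (((R x).1 *ᵥ u) 0) ∧ v s ≤ v (((R x).1 *ᵥ u) 0)
  obtain ⟨d⟩ := Monoid.PushoutI.NormalWord.transversal_nonempty
    (fun _ : Fin 2 => C.subtype) (fun _ => C.subtype_injective)
  -- Growth comes only from letters of the second copy, so a word reduced to a single element of the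
  -- first copy needs its own alternative; injectivity of `ρ` handles it at the end.
  have key (w : Monoid.PushoutI.NormalWord d) :
      (w.fstIdx = none → ∃ c, w.prod = Monoid.PushoutI.base _ c) ∧
      (w.fstIdx = some 0 →
        (∃ f ∉ C, w.prod = Monoid.PushoutI.of (0 : Fin 2) f) ∨ B0 w.prod) ∧
      (w.fstIdx = some 1 → B1 w.prod) := by
    induction w using Monoid.PushoutI.NormalWord.consRecOn with
    | empty =>
      have hidx : (Monoid.PushoutI.NormalWord.empty (d := d)).fstIdx = none := rfl
      rw [hidx]
      exact ⟨fun _ => ⟨1, by simp⟩, by simp, by simp⟩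
    | cons i g w hmw _ hgr _ ih =>
      have hg : g ∉ C := by simpa using hgr
      have hidx : (Monoid.PushoutI.NormalWord.cons g w hmw hgr).fstIdx = some i := by
        simp [Monoid.PushoutI.NormalWord.cons]
      rw [hidx, Monoid.PushoutI.NormalWord.prod_cons]
      obtain ⟨ih0, ih1, ih2⟩ := ih
      have hzero (u : Fin 2 → M) (x : DoubleGroup C) (hg : g ∉ C)
          (h : v (((R x).1 *ᵥ u) 1) < v (((R x).1 *ᵥ u) 0)) :=
        ping_zero v (hint g) (hlow g hg) h
      have hone (u : Fin 2 → M) (x : DoubleGroup C) (hg : g ∉ C)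
          (h : v (((R x).1 *ᵥ u) 0) ≤ v (((R x).1 *ᵥ u) 1)) :=
        ping_one v hvs (hint g) (hup g hg) (hR1 g) h
      refine ⟨by simp, fun hi => ?_, fun hi => ?_⟩
      · obtain rfl : i = 0 := by simpa using hi
        match hw : w.fstIdx with
        | none =>
          obtain ⟨c, hc⟩ := ih0 hw
          refine Or.inl ⟨g * c, fun h => hg ((C.mul_mem_cancel_right c.2).1 h), ?_⟩
          rw [hc, map_mul, ← Monoid.PushoutI.of_apply_eq_base _ (0 : Fin 2)]
          rfl
        | some 0 => exact absurd hw hmw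
        | some 1 =>
          obtain ⟨u, hu, h, hmax⟩ := ih2 hw
          obtain ⟨h1, h2⟩ := hzero u _ hg h
          refine Or.inr ⟨u, hu, ?_⟩
          rw [hRmul, hR0]
          exact ⟨h1, hmax.trans h2.ge⟩
      · obtain rfl : i = 1 := by simpa using hi
        match hw : w.fstIdx with
        | none =>
          obtain ⟨c, hc⟩ := ih0 hw
          refine ⟨![0, 1], by simp [Fin.forall_fin_two], ?_⟩
          rw [hRmul]
          exact hone _ _ hg (by rw [hc, hbase, hbase]; simp) (by rw [hc, hbase]; simp)
        | some 0 =>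
          obtain ⟨f, hf, hfx⟩ | ⟨u, hu, h, hmax⟩ := ih1 hw
          -- The innermost letter lies in the first copy: it sends `(1, 0)` to its first column,
          -- whose lower entry is a unit.
          · refine ⟨![1, 0], by simp [Fin.forall_fin_two], ?_⟩
            obtain ⟨h1, h2⟩ := ping_zero v (u := ![1, 0]) (hint f) (hlow f hf) (by simp)
            rw [hRmul]
            refine hone _ _ hg ?_ ?_
            · rwa [hfx, hR0]
            · rw [hfx, hR0, h2]; simp
          · refine ⟨u, hu, ?_⟩
            rw [hRmul]
            exact hone _ _ hg h (hvs.le.trans hmax)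
        | some 1 => exact absurd hw hmw
    | base h w _ ih =>
      have hidx : (Monoid.PushoutI.base (fun _ : Fin 2 => C.subtype) h • w).fstIdx = w.fstIdx := by
        rw [Monoid.PushoutI.NormalWord.base_smul_def]
      rw [hidx, Monoid.PushoutI.NormalWord.prod_smul]
      obtain ⟨ih0, ih1, ih2⟩ := ih
      refine ⟨fun hi => ?_, fun hi => ?_, fun hi => ?_⟩
      · obtain ⟨c, hc⟩ := ih0 hi
        exact ⟨h * c, by rw [hc, map_mul]⟩
      · obtain ⟨f, hf, hfx⟩ | ⟨u, hu, hB⟩ := ih1 hi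
        · refine Or.inl ⟨h * f, fun hh => hf ((C.mul_mem_cancel_left h.2).1 hh), ?_⟩
          rw [hfx, map_mul, ← Monoid.PushoutI.of_apply_eq_base _ (0 : Fin 2), Subgroup.subtype_apply]
        · refine Or.inr ⟨u, hu, ?_⟩
          rwa [hRmul, hbase, hbase]
      · obtain ⟨u, hu, hB⟩ := ih2 hi
        refine ⟨u, hu, ?_⟩
        rwa [hRmul, hbase, hbase]
  rw [injective_iff_map_eq_one]
  intro x hx
  obtain ⟨w, rfl⟩ : ∃ w : Monoid.PushoutI.NormalWord d, w.prod = x :=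
    ⟨Monoid.PushoutI.NormalWord.equiv x, Monoid.PushoutI.NormalWord.equiv.left_inv x⟩
  obtain ⟨k0, k1, k2⟩ := key w
  match hw : w.fstIdx with
  | none =>
    obtain ⟨c, hc⟩ := k0 hw
    rw [hc, hRb] at hx
    rw [hc, show c = 1 from Subtype.ext (hρ (by simpa using hx)), map_one]
  | some 0 =>
    obtain ⟨f, hf, hfx⟩ | ⟨u, hu, -, h⟩ := k1 hw
    · rw [hfx, hR0] at hx
      exact absurd C.one_mem ((hρ (hx.trans (map_one ρ).symm)) ▸ hf)
    · rw [hx] at h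
      exact absurd (h.trans (by simpa using hu 1)) (not_le_of_gt hvs)
  | some 1 =>
    obtain ⟨u, hu, -, h⟩ := k2 hw
    rw [hx] at h
    exact absurd (h.trans (by simpa using hu 0)) (not_le_of_gt hvs)

end Double

end

/-! ### Centralizer of the commutator in the free group of rank two. -/

/-- The integral Heisenberg group. -/
@[ext]
structure Heisenberg where
  x : ℤ
  y : ℤ
  z : ℤ

namespace Heisenberg

instance : Mul Heisenberg := ⟨fun a b => ⟨a.x + b.x, a.y + b.y, a.z + b.z + a.x * b.y⟩⟩
instance : One Heisenberg := ⟨⟨0, 0, 0⟩⟩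
instance : Inv Heisenberg := ⟨fun a => ⟨-a.x, -a.y, -a.z + a.x * a.y⟩⟩

@[simp] theorem mul_x (a b : Heisenberg) : (a * b).x = a.x + b.x := rfl
@[simp] theorem mul_y (a b : Heisenberg) : (a * b).y = a.y + b.y := rfl
@[simp] theorem mul_z (a b : Heisenberg) : (a * b).z = a.z + b.z + a.x * b.y := rfl
@[simp] theorem one_x : (1 : Heisenberg).x = 0 := rfl
@[simp] theorem one_y : (1 : Heisenberg).y = 0 := rfl
@[simp] theorem one_z : (1 : Heisenberg).z = 0 := rfl
@[simp] theorem inv_x (a : Heisenberg) : (a⁻¹).x = -a.x := rfl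
@[simp] theorem inv_y (a : Heisenberg) : (a⁻¹).y = -a.y := rfl
@[simp] theorem inv_z (a : Heisenberg) : (a⁻¹).z = -a.z + a.x * a.y := rfl

instance : Group Heisenberg :=
  Group.ofLeftAxioms (by intros; ext <;> simp <;> ring) (by intros; ext <;> simp)
    (by intros; ext <;> simp)

theorem zpow_x (a : Heisenberg) (k : ℤ) : (a ^ k).x = k * a.x := by
  induction k with
  | zero => simp
  | succ i ih => rw [zpow_add_one, mul_x, ih]; ring
  | pred i ih => rw [zpow_sub_one, mul_x, ih, inv_x]; ring

theorem zpow_z (a : Heisenberg) (hx : a.x = 0) (k : ℤ) : (a ^ k).z = k * a.z := by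
  induction k with
  | zero => simp
  | succ i ih => rw [zpow_add_one, mul_z, ih, zpow_x, hx]; ring
  | pred i ih => rw [zpow_sub_one, mul_z, ih, zpow_x, inv_z, hx]; ring

end Heisenberg

/-- The commutator of the two generators of a free group of rank two. -/
def freeCommutator : FreeGroup Bool := 
  FreeGroup.of false * FreeGroup.of true * (FreeGroup.of false)⁻¹ * (FreeGroup.of true)⁻¹

theorem freeCommutator_ne_one : freeCommutator ≠ 1 := by
  intro h
  have := congrArg (fun f => (FreeGroup.lift
    (fun b : Bool => if b then (⟨0, 1, 0⟩ : Heisenberg) else ⟨1, 0, 0⟩) f).z) h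
  simp [freeCommutator] at this

/-- In the Heisenberg group the commutator becomes the generator `(0, 0, 1)` of the centre. A `k`-th
root of it has `x = 0`, where `z` is additive on powers, so `k` divides `1`. -/
theorem isUnit_of_zpow_eq_freeCommutator {f : FreeGroup Bool} {k : ℤ}
    (h : f ^ k = freeCommutator) : IsUnit k := by
  set φ := FreeGroup.lift (fun b : Bool => if b then (⟨0, 1, 0⟩ : Heisenberg) else ⟨1, 0, 0⟩) with hφ
  have hc : φ f ^ k = ⟨0, 0, 1⟩ := by
    rw [← map_zpow, h]
    ext <;> simp [hφ, freeCommutator]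
  have hk : k ≠ 0 := by rintro rfl; exact freeCommutator_ne_one (by simpa using h.symm)
  have hx : (φ f).x = 0 := by
    have := congrArg Heisenberg.x hc
    rw [Heisenberg.zpow_x] at this
    simpa [hk] using this
  have hz := congrArg Heisenberg.z hc
  rw [Heisenberg.zpow_z _ hx] at hz
  exact IsUnit.of_mul_eq_one _ hz

/-- Commuting elements of a free group are powers of a common element. -/
theorem FreeGroup.exists_zpow_of_commute {α : Type*} {x y : FreeGroup α} (h : Commute x y) :
    ∃ z : FreeGroup α, x ∈ Subgroup.zpowers z ∧ y ∈ Subgroup.zpowers z := by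
  set H := Subgroup.closure {x, y} with hH
  have hcomm : ∀ a b : H, a * b = b * a := by
    have : IsMulCommutative H := Subgroup.isMulCommutative_closure (by
      rintro a (rfl | rfl) b (rfl | rfl)
      · rfl
      · exact h
      · exact h.symm
      · rfl)
    exact fun a b => this.is_comm.comm a b
  -- The subgroup generated by `x` and `y` is free by Nielsen–Schreier, and abelian. Two distinct
  -- free generators could be mapped to noncommuting elements of the Heisenberg group.
  have hsub : Subsingleton (IsFreeGroup.Generators H) := by
    refine ⟨fun i j => ?_⟩
    by_contra hij
    classical
    have h1 := congrArg (IsFreeGroup.lift (fun k : IsFreeGroup.Generators H =>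
      if k = i then (⟨0, 1, 0⟩ : Heisenberg) else ⟨1, 0, 0⟩))
      (hcomm (IsFreeGroup.of i) (IsFreeGroup.of j))
    have := congrArg Heisenberg.z h1
    simp [Ne.symm hij] at this
  have hgen : ∃ z : H, ∀ a : H, a ∈ Subgroup.zpowers z := by
    have hcyc : IsCyclic (FreeGroup (IsFreeGroup.Generators H)) := by
      obtain h | h := isEmpty_or_nonempty (IsFreeGroup.Generators H)
      · infer_instance
      · have := (unique_iff_subsingleton_and_nonempty (IsFreeGroup.Generators H)).2 ⟨hsub, h⟩
        have := this.some
        infer_instance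
    exact ((IsFreeGroup.mulEquiv H).isCyclic.1 hcyc).exists_generator
  obtain ⟨z, hz⟩ := hgen
  have key (a : FreeGroup α) (ha : a ∈ H) : a ∈ Subgroup.zpowers (z : FreeGroup α) := by
    obtain ⟨k, hk⟩ := Subgroup.mem_zpowers_iff.1 (hz ⟨a, ha⟩)
    exact Subgroup.mem_zpowers_iff.2 ⟨k, by simpa using congrArg Subtype.val hk⟩
  exact ⟨z, key x (Subgroup.subset_closure (by simp)), key y (Subgroup.subset_closure (by simp))⟩

theorem mem_zpowers_freeCommutator_of_commute {f : FreeGroup Bool}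
    (h : Commute f freeCommutator) : f ∈ Subgroup.zpowers freeCommutator := by
  obtain ⟨z, hf, hc⟩ := FreeGroup.exists_zpow_of_commute h
  obtain ⟨k, hk⟩ := Subgroup.mem_zpowers_iff.1 hc
  have hz : z ∈ Subgroup.zpowers freeCommutator := by
    obtain rfl | rfl := Int.isUnit_iff.1 (isUnit_of_zpow_eq_freeCommutator hk)
    · rw [← hk]; simp
    · rw [← hk]; simp
  exact (Subgroup.zpowers_le.2 hz) hf

/-! ### Off-diagonal entries in characteristic `p`. -/

theorem one_add_pow_char_of_sq_eq_zero {L : Type*} [Field L] (p : ℕ) [Fact p.Prime]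
    [CharP L p] {N : Matrix (Fin 2) (Fin 2) L} (hN : N * N = 0) :
    (1 + N) ^ p = 1 := by
  rw [add_pow_char_of_commute p (Commute.one_left N), one_pow,
    pow_eq_zero_of_le (Fact.out : p.Prime).two_le (by rw [pow_two, hN]), add_zero]

/-- A triangular matrix and a diagonal one have a unipotent commutator, which characteristic `p`
forces to be torsion. -/
theorem mem_zpowers_of_corner_eq_zero {L : Type*} [Field L] (p : ℕ) [Fact p.Prime]
    [CharP L p] {ρ : FreeGroup Bool →* GL (Fin 2) L}
    (hρ : Function.Injective ρ) (hc01 : (ρ freeCommutator).1 0 1 = 0)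
    (hc10 : (ρ freeCommutator).1 1 0 = 0) {f : FreeGroup Bool}
    (hf : (ρ f).1 0 1 = 0 ∨ (ρ f).1 1 0 = 0) : f ∈ Subgroup.zpowers freeCommutator := by
  set c := freeCommutator
  refine mem_zpowers_freeCommutator_of_commute ?_
  have key : ∃ N : Matrix (Fin 2) (Fin 2) L, N * N = 0 ∧
      (ρ f).1 * (ρ c).1 = (1 + N) * ((ρ c).1 * (ρ f).1) := by
    have hdc := (ρ c).isUnit.map Matrix.detMonoidHom
    have hdf := (ρ f).isUnit.map Matrix.detMonoidHom
    simp only [Matrix.coe_detMonoidHom, Matrix.det_fin_two, isUnit_iff_ne_zero] at hdc hdf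
    set X := (ρ f).1
    set Y := (ρ c).1
    change Y 0 0 * Y 1 1 - Y 0 1 * Y 1 0 ≠ 0 at hdc
    change X 0 0 * X 1 1 - X 0 1 * X 1 0 ≠ 0 at hdf
    rw [hc01, zero_mul, sub_zero, mul_ne_zero_iff] at hdc
    obtain ⟨h0, h1⟩ := hdc
    obtain h | h := hf
    · rw [h, zero_mul, sub_zero, mul_ne_zero_iff] at hdf
      obtain ⟨g0, g1⟩ := hdf
      -- The entry is read off from the lower left corner of `X * Y = (1 + N) * (Y * X)`; the
      -- diagonals of `X * Y` and `Y * X` agree.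
      refine ⟨!![0, 0; (X 1 0 * Y 0 0 - Y 1 1 * X 1 0) / (Y 0 0 * X 0 0), 0], ?_, ?_⟩
      · ext i j; fin_cases i <;> fin_cases j <;> simp
      · ext i j
        fin_cases i <;> fin_cases j <;>
          simp [add_mul, Matrix.mul_apply, Fin.sum_univ_two, h, hc01, hc10] <;> field_simp <;> ring
    · rw [h, mul_zero, sub_zero, mul_ne_zero_iff] at hdf
      obtain ⟨g0, g1⟩ := hdf
      refine ⟨!![0, (X 0 1 * Y 1 1 - Y 0 0 * X 0 1) / (Y 1 1 * X 1 1); 0, 0], ?_, ?_⟩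
      · ext i j; fin_cases i <;> fin_cases j <;> simp
      · ext i j
        fin_cases i <;> fin_cases j <;>
          simp [add_mul, Matrix.mul_apply, Fin.sum_univ_two, h, hc01, hc10] <;> field_simp <;> ring
  obtain ⟨N, hN, hNe⟩ := key
  have h1 : (ρ (f * c * (c * f)⁻¹)).1 = 1 + N := by
    rw [map_mul, map_inv, Units.val_mul]
    rw [Units.mul_inv_eq_iff_eq_mul, map_mul, map_mul, Units.val_mul, Units.val_mul, hNe]
  have h2 : (f * c * (c * f)⁻¹) ^ p = 1 ^ p := by
    apply hρ
    apply Units.ext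
    rw [map_pow, Units.val_pow_eq_pow_val, h1, one_add_pow_char_of_sq_eq_zero p hN]
    simp
  -- Free groups are torsion-free.
  have h3 := pow_left_injective (Fact.out : p.Prime).ne_zero h2
  exact mul_inv_eq_one.1 h3

/-! ### A Schottky representation with diagonal commutator. -/

section Schottky

variable {L : Type} {Γ : Type*} [Field L] [LinearOrderedCommGroupWithZero Γ]

/-- The invertible matrix with columns `(1, 1)` and `(1, -1)`. -/
def hadamard (h2 : (2 : L) ≠ 0) : GL (Fin 2) L where
  val := !![1, 1; 1, -1]
  inv := !![2⁻¹, 2⁻¹; 2⁻¹, -2⁻¹]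
  val_inv := by
    ext i j; fin_cases i <;> fin_cases j <;> simp <;> field_simp <;> norm_num
  inv_val := by
    ext i j; fin_cases i <;> fin_cases j <;> simp <;> field_simp <;> norm_num

/-- The homomorphism sending the generators of the free group to `diag (t, 1)` and its conjugate
by the Hadamard matrix. -/
def schottky (h2 : (2 : L) ≠ 0) (t : L) (ht : t ≠ 0) : FreeGroup Bool →* GL (Fin 2) L :=
  FreeGroup.lift fun b : Bool =>
    if b then hadamard h2 * diagOne t ht * (hadamard h2)⁻¹ else diagOne t ht

theorem exists_first_column_ne_zero (B : GL (Fin 2) L) : B.1 0 0 ≠ 0 ∨ B.1 1 0 ≠ 0 := by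
  by_contra! h
  have := B.isUnit.map Matrix.detMonoidHom
  simp [Matrix.det_fin_two, h.1, h.2] at this

theorem diagOne_mul_apply {t : L} (ht : t ≠ 0) (B : GL (Fin 2) L) :
    (diagOne t ht * B).1 0 0 = t * B.1 0 0 ∧ (diagOne t ht * B).1 1 0 = B.1 1 0 := by
  rw [Units.val_mul]
  constructor <;> simp [diagOne, Matrix.vecMul, dotProduct, Fin.sum_univ_two]

theorem diagOne_inv_mul_apply {t : L} (ht : t ≠ 0) (B : GL (Fin 2) L) :
    ((diagOne t ht)⁻¹ * B).1 0 0 = t⁻¹ * B.1 0 0 ∧ ((diagOne t ht)⁻¹ * B).1 1 0 = B.1 1 0 := by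
  have : ((diagOne t ht)⁻¹).1 = !![t⁻¹, 0; 0, 1] := rfl
  rw [Units.val_mul, this]
  constructor <;> simp [Matrix.vecMul, dotProduct, Fin.sum_univ_two]

theorem hadamard_inv_mul_apply (h2 : (2 : L) ≠ 0) (B : GL (Fin 2) L) :
    ((hadamard h2)⁻¹ * B).1 0 0 = 2⁻¹ * (B.1 0 0 + B.1 1 0) ∧
      ((hadamard h2)⁻¹ * B).1 1 0 = 2⁻¹ * (B.1 0 0 - B.1 1 0) := by
  have : ((hadamard h2)⁻¹).1 = !![2⁻¹, 2⁻¹; 2⁻¹, -2⁻¹] := rfl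
  rw [Units.val_mul, this]
  constructor <;> simp [Matrix.vecMul, dotProduct, Fin.sum_univ_two] <;> ring

/-- Ping-pong takes place on invertible matrices, sorted by the dominant entry of the first column,
a nonzero vector. The sets for the second generator are the Hadamard translates of those for the
first. -/
theorem schottky_injective (v : Valuation L Γ) (h2 : (2 : L) ≠ 0) {t : L}
    (ht : t ≠ 0) (hvt : 1 < v t) : Function.Injective (schottky h2 t ht) := by
  let up : Set (GL (Fin 2) L) := {B | v (B.1 1 0) < v (B.1 0 0)}
  let dn : Set (GL (Fin 2) L) := {B | v (B.1 0 0) < v (B.1 1 0)}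
  have hup (B : GL (Fin 2) L) (h : B ∉ dn) : diagOne t ht * B ∈ up := by
    simp only [dn, up, Set.mem_ofPred_eq, not_lt, diagOne_mul_apply, map_mul] at h ⊢
    refine h.trans_lt (lt_mul_of_one_lt_left ?_ hvt)
    rw [Valuation.pos_iff]
    intro h0
    rw [h0, map_zero, le_zero_iff, map_eq_zero] at h
    exact (exists_first_column_ne_zero B).elim (· h0) (· h)
  have hdn (B : GL (Fin 2) L) (h : B ∉ up) : (diagOne t ht)⁻¹ * B ∈ dn := by
    simp only [dn, up, Set.mem_ofPred_eq, not_lt, diagOne_inv_mul_apply, map_mul, map_inv₀] at h ⊢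
    have h1 : 0 < v (B.1 1 0) := by
      rw [Valuation.pos_iff]
      intro h0
      rw [h0, map_zero, le_zero_iff, map_eq_zero] at h
      exact (exists_first_column_ne_zero B).elim (· h) (· h0)
    calc (v t)⁻¹ * v (B.1 0 0) ≤ (v t)⁻¹ * v (B.1 1 0) := by gcongr
      _ < v (B.1 1 0) := mul_lt_of_lt_one_left h1 (inv_lt_one_of_one_lt₀ hvt)
  have hud (B : GL (Fin 2) L) : B ∈ up → B ∉ dn := fun h => not_lt_of_gt h
  -- If one entry strictly dominates, the sum and the difference have equal valuation, so neither
  -- coordinate dominates after the inverse Hadamard matrix. This makes the four sets disjoint.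
  have hH (B : GL (Fin 2) L) (h : B ∈ up ∨ B ∈ dn) :
      (hadamard h2)⁻¹ * B ∉ up ∧ (hadamard h2)⁻¹ * B ∉ dn := by
    have : v (B.1 0 0 + B.1 1 0) = v (B.1 0 0 - B.1 1 0) := by
      obtain h | h := h
      · rw [Valuation.map_add_eq_of_lt_left v h, Valuation.map_sub_eq_of_lt_left v h]
      · rw [Valuation.map_add_eq_of_lt_right v h, Valuation.map_sub_eq_of_lt_right v h]
    simp [up, dn, hadamard_inv_mul_apply, this]
  refine FreeGroup.injective_lift_of_ping_pong _ (α := GL (Fin 2) L)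
    (fun b : Bool => if b then {B | (hadamard h2)⁻¹ * B ∈ up} else up)
    (fun b : Bool => if b then {B | (hadamard h2)⁻¹ * B ∈ dn} else dn) ?_ ?_ ?_ ?_ ?_ ?_
  · rintro (_ | _)
    · exact ⟨1, by simp [up]⟩
    · exact ⟨hadamard h2, by simp [up]⟩
  · rintro (_ | _) (_ | _) h <;> simp only [ne_eq, not_true_eq_false] at h
    · exact Set.disjoint_left.2 fun B hB hB' => (hH B (.inl hB)).1 hB'
    · exact Set.disjoint_right.2 fun B hB hB' => (hH B (.inl hB)).1 hB'
  · rintro (_ | _) (_ | _) h <;> simp only [ne_eq, not_true_eq_false] at h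
    · exact Set.disjoint_left.2 fun B hB hB' => (hH B (.inr hB)).2 hB'
    · exact Set.disjoint_right.2 fun B hB hB' => (hH B (.inr hB)).2 hB'
  · rintro (_ | _) (_ | _) <;> refine Set.disjoint_left.2 fun B hB hB' => ?_
    · exact hud B hB hB'
    · exact (hH B (.inl hB)).2 hB'
    · exact (hH B (.inr hB')).1 hB
    · exact hud _ hB hB'
  · rintro (_ | _) _ ⟨B, hB, rfl⟩
    · exact hup B hB
    · have := hup _ hB
      simpa [mul_assoc] using this
  · rintro (_ | _) _ ⟨B, hB, rfl⟩
    · exact hdn B hB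
    · have := hdn _ hB
      simpa [mul_assoc] using this

/-- The commutator of the two generators in the Schottky representation. -/
theorem schottky_freeCommutator (h2 : (2 : L) ≠ 0) (t : L) (ht : t ≠ 0) :
    (schottky h2 t ht freeCommutator).1 =
      !![((t + 1) ^ 2 - t * (t - 1) ^ 2) / (4 * t), (t ^ 2 - 1) * (t - 1) / (4 * t);
        (t ^ 2 - 1) * (1 - t) / (4 * t ^ 2), (t * (t + 1) ^ 2 - (t - 1) ^ 2) / (4 * t ^ 2)] := by
  have h4 : (4 : L) ≠ 0 := by
    have : (4 : L) = 2 * 2 := by norm_num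
    rw [this]; exact mul_ne_zero h2 h2
  have hd : ((diagOne t ht)⁻¹).1 = !![t⁻¹, 0; 0, 1] := rfl
  have hh : ((hadamard h2)⁻¹).1 = !![2⁻¹, 2⁻¹; 2⁻¹, -2⁻¹] := rfl
  have hd' : (diagOne t ht).1 = !![t, 0; 0, 1] := rfl
  have hh' : (hadamard h2).1 = !![1, 1; 1, -1] := rfl
  have : schottky h2 t ht freeCommutator = diagOne t ht *
      (hadamard h2 * diagOne t ht * (hadamard h2)⁻¹) * (diagOne t ht)⁻¹ *
      (hadamard h2 * (diagOne t ht)⁻¹ * (hadamard h2)⁻¹) := by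
    simp [schottky, freeCommutator, mul_assoc]
  rw [this]
  simp only [Units.val_mul, hd, hh, hd', hh']
  ext i j
  fin_cases i <;> fin_cases j <;> simp <;> field_simp <;> ring

end Schottky

/-- The matrix of eigenvectors of the commutator in the Schottky representation. -/
def eigenMatrix {L : Type} [Field L] (h2 : (2 : L) ≠ 0) (t w : L) (hw : w ≠ 0) :
    GL (Fin 2) L :=
  Matrix.GeneralLinearGroup.mkOfDetNeZero !![1 - t + w, 1 - t - w; -2, -2] (by
    rw [Matrix.det_fin_two_of]
    have : (1 - t + w) * -2 - (1 - t - w) * -2 = -(2 * 2 * w) := by ring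
    rw [this, neg_ne_zero]
    exact mul_ne_zero (mul_ne_zero h2 h2) hw)

/-- The discriminant of the characteristic polynomial of the commutator is `t ^ 2 - 6 * t + 1` up to
a square factor, so a square root `w` makes it diagonalizable over `L`. -/
theorem schottky_freeCommutator_mul_eigenMatrix {L : Type} [Field L] (h2 : (2 : L) ≠ 0)
    {t w : L} (ht : t ≠ 0) (hw : w ≠ 0) (htw : w ^ 2 = t ^ 2 - 6 * t + 1) :
    ∃ m n : L, (schottky h2 t ht freeCommutator).1 * (eigenMatrix h2 t w hw).1 =
      (eigenMatrix h2 t w hw).1 * !![m, 0; 0, n] := by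
  have h8 : (8 : L) ≠ 0 := by
    have : (8 : L) = 2 * 2 * 2 := by norm_num
    rw [this]; exact mul_ne_zero (mul_ne_zero h2 h2) h2
  have h4 : (4 : L) ≠ 0 := by
    have : (4 : L) = 2 * 2 := by norm_num
    rw [this]; exact mul_ne_zero h2 h2
  have he : (eigenMatrix h2 t w hw).1 = !![1 - t + w, 1 - t - w; -2, -2] := rfl
  refine ⟨(2 * t * (t + 1) ^ 2 - (t ^ 2 + 1) * (t - 1) ^ 2 + (t - 1) ^ 2 * (t + 1) * w) /
    (8 * t ^ 2), (2 * t * (t + 1) ^ 2 - (t ^ 2 + 1) * (t - 1) ^ 2 -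
      (t - 1) ^ 2 * (t + 1) * w) / (8 * t ^ 2), ?_⟩
  rw [he, schottky_freeCommutator]
  ext i j
  fin_cases i <;> fin_cases j
  · simp
    field_simp
    linear_combination (-(4 * (t - 1) ^ 2 * (t + 1))) * htw
  · simp
    field_simp
    linear_combination (-(4 * (t - 1) ^ 2 * (t + 1))) * htw
  · simp
    field_simp
    ring
  · simp
    field_simp
    ring

theorem exists_injective_freeCommutator_diagonal {L : Type} {Γ : Type*} [Field L]
    [LinearOrderedCommGroupWithZero Γ] (v : Valuation L Γ) (hv2 : v 2 = 1) {t w : L}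
    (hvt : 1 < v t) (hw : w ≠ 0) (htw : w ^ 2 = t ^ 2 - 6 * t + 1) :
    ∃ ρ : FreeGroup Bool →* GL (Fin 2) L, Function.Injective ρ ∧
      (ρ freeCommutator).1 0 1 = 0 ∧ (ρ freeCommutator).1 1 0 = 0 := by
  have h2 : (2 : L) ≠ 0 := by rintro h; simp [h] at hv2
  have ht : t ≠ 0 := by rintro rfl; simp at hvt
  obtain ⟨m, n, h⟩ := schottky_freeCommutator_mul_eigenMatrix h2 ht hw htw
  set P := eigenMatrix h2 t w hw
  refine ⟨(MulAut.conj P⁻¹).toMonoidHom.comp (schottky h2 t ht), ?_, ?_⟩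
  · exact (MulAut.conj P⁻¹).injective.comp (schottky_injective v h2 ht hvt)
  · have key : (((MulAut.conj P⁻¹).toMonoidHom.comp (schottky h2 t ht)) freeCommutator).1 =
        !![m, 0; 0, n] := by
      have : ((MulAut.conj P⁻¹).toMonoidHom.comp (schottky h2 t ht)) freeCommutator =
          P⁻¹ * (schottky h2 t ht freeCommutator * P) := by simp [mul_assoc]
      rw [this, Units.val_mul, Units.val_mul, h, ← mul_assoc, ← Units.val_mul, inv_mul_cancel,
        Units.val_one, one_mul]
    rw [key]
    simp

/-- The subgroup of diagonal matrices. -/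
def diagonalSubgroup (L : Type*) [Field L] : Subgroup (GL (Fin 2) L) where
  carrier := {A | A.1 0 1 = 0 ∧ A.1 1 0 = 0}
  one_mem' := by simp
  mul_mem' := by
    rintro A B ⟨h1, h2⟩ ⟨h3, h4⟩
    simp [Matrix.mul_apply, Fin.sum_univ_two, h1, h2, h3, h4]
  inv_mem' := by
    rintro A ⟨h1, h2⟩
    simp [Matrix.coe_units_inv, Matrix.inv_def, Matrix.adjugate_fin_two, h1, h2]

/-! ### A faithful representation of the double. -/

/-- The double of the free group of rank two along the commutator of its generators. -/
abbrev FreeDouble : Type := DoubleGroup (Subgroup.zpowers freeCommutator)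

/-- The inner variable serves the Schottky group, the outer one the ping-pong for the double. The
outer valuation is trivial on constants, so a nonzero entry of `ρ f` automatically has valuation
one. -/
theorem exists_freeDouble_injective_ratFunc_ratFunc (p : ℕ) [Fact p.Prime] (hp : 2 < p) :
    ∃ R : FreeDouble →* GL (Fin 2) (RatFunc (RatFunc (ZMod p))), Function.Injective R := by
  classical
  have h2z : (2 : ZMod p) ≠ 0 := by
    intro h
    have := (ZMod.natCast_eq_zero_iff 2 p).1 (by exact_mod_cast h)
    exact absurd (Nat.le_of_dvd (by norm_num) this) (by omega)
  set L := RatFunc (ZMod p)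
  let τ : L := RatFunc.X
  have hτ : τ ≠ 0 := RatFunc.X_ne_zero
  let v := RatFunc.inftyValuation (ZMod p)
  have hvτ : 1 < v τ := by
    rw [RatFunc.inftyValuation.X, ← WithZero.exp_zero, WithZero.exp_lt_exp]
    norm_num
  have hvinv : v τ⁻¹ < 1 := by
    rw [map_inv₀]
    exact inv_lt_one_of_one_lt₀ hvτ
  have hv2 : v 2 = 1 := by
    have := RatFunc.inftyValuation.C (ZMod p) h2z
    rwa [map_ofNat] at this
  have hv2τ : v (2 * τ) = v τ := by rw [map_mul, hv2, one_mul]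
  have hv3 : v 3 ≤ 1 := by
    have := Valuation.IsTrivialOn.valuation_algebraMap_le_one v (3 : ZMod p)
    rwa [map_ofNat] at this
  have hvt : v (3 + 2 * τ + τ⁻¹) = v τ := by
    have h3 : v (3 + 2 * τ) = v τ := by
      rw [Valuation.map_add_eq_of_lt_right, hv2τ]
      rw [hv2τ]
      exact hv3.trans_lt hvτ
    rw [Valuation.map_add_eq_of_lt_left, h3]
    rw [h3]
    exact hvinv.trans hvτ
  have hvw : 2 * τ - τ⁻¹ ≠ 0 := by
    intro h
    rw [sub_eq_zero] at h
    rw [← h, hv2τ] at hvinv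
    exact lt_asymm hvinv hvτ
  -- The conic reads `(t - 3 + w) * (t - 3 - w) = 8`; the two factors are taken to be `4 * τ` and `2
  -- * τ⁻¹`.
  obtain ⟨ρ, hρ, h01, h10⟩ := exists_injective_freeCommutator_diagonal v hv2
    (t := 3 + 2 * τ + τ⁻¹) (w := 2 * τ - τ⁻¹) (hvt ▸ hvτ) hvw (by field_simp; ring)
  let u := RatFunc.inftyValuation L
  let σ := (Matrix.GeneralLinearGroup.map (n := Fin 2) (RatFunc.C : L →+* RatFunc L)).comp ρ
  have hσ (f : FreeGroup Bool) (i j : Fin 2) : (σ f).1 i j = RatFunc.C ((ρ f).1 i j) := rfl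
  have hdiag (c : FreeGroup Bool) (hc : c ∈ Subgroup.zpowers freeCommutator) :
      (ρ c).1 0 1 = 0 ∧ (ρ c).1 1 0 = 0 := by
    have : Subgroup.zpowers freeCommutator ≤ (diagonalSubgroup L).comap ρ :=
      Subgroup.zpowers_le.2 ⟨h01, h10⟩
    exact this hc
  have hne (c : FreeGroup Bool) (hc : c ∈ Subgroup.zpowers freeCommutator) :
      (ρ c).1 0 0 ≠ 0 ∧ (ρ c).1 1 1 ≠ 0 := by
    have := (ρ c).isUnit.map Matrix.detMonoidHom
    simpa [Matrix.det_fin_two, (hdiag c hc).1] using this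
  have hcorner (f : FreeGroup Bool) (hf : f ∉ Subgroup.zpowers freeCommutator) :
      (ρ f).1 0 1 ≠ 0 ∧ (ρ f).1 1 0 ≠ 0 := by
    have : CharP L p := charP_of_injective_algebraMap (algebraMap (ZMod p) L).injective p
    rw [← not_or]
    exact fun h => hf (mem_zpowers_of_corner_eq_zero p hρ h01 h10 h)
  have hu (k : L) (hk : k ≠ 0) : u (RatFunc.C k) = 1 := RatFunc.inftyValuation.C L hk
  refine ⟨_, doubleRep_injective (C := Subgroup.zpowers freeCommutator) u σ ?_ ?_
    (fun f hf => hu _ (hcorner f hf).1) (fun f hf => hu _ (hcorner f hf).2)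
    (fun c hc => by rw [hσ, (hdiag c hc).1, map_zero])
    (fun c hc => by rw [hσ, (hdiag c hc).2, map_zero])
    (fun c hc => hu _ (hne c hc).1) (fun c hc => hu _ (hne c hc).2)
    (s := RatFunc.X) RatFunc.X_ne_zero ?_ ?_⟩
  · refine fun f f' h => hρ (Units.ext ?_)
    ext i j
    exact RatFunc.C.injective (congrArg (fun M : GL (Fin 2) (RatFunc L) => M.1 i j) h)
  · exact fun f i j => Valuation.IsTrivialOn.valuation_algebraMap_le_one u ((ρ f).1 i j)
  · rw [RatFunc.inftyValuation.X, ← WithZero.exp_zero, WithZero.exp_lt_exp]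
    norm_num
  · intro c hc
    rw [mul_inv_eq_iff_eq_mul]
    have h1 : (σ c).1 0 1 = 0 := by rw [hσ, (hdiag c hc).1, map_zero]
    have h2 : (σ c).1 1 0 = 0 := by rw [hσ, (hdiag c hc).2, map_zero]
    apply Units.ext
    ext i j
    fin_cases i <;> fin_cases j <;>
      simp [diagOne, Matrix.mul_apply, Fin.sum_univ_two, h1, h2, mul_comm]

/-! ### Surface groups inside the double, through cyclic covers. -/

section SurfaceGroup

/-- The product of the commutators of the first `k` pairs of elements. -/
def commProd {Γ : Type*} [Group Γ] (a b : ℕ → Γ) : ℕ → Γ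
  | 0 => 1
  | k + 1 => commProd a b k * (a k * b k * (a k)⁻¹ * (b k)⁻¹)

theorem map_commProd {Γ Δ : Type*} [Group Γ] [Group Δ] (φ : Γ →* Δ) (a b : ℕ → Γ) (k : ℕ) :
    φ (commProd a b k) = commProd (fun i => φ (a i)) (fun i => φ (b i)) k := by
  induction k with
  | zero => simp [commProd]
  | succ k ih => simp [commProd, ih]

theorem commProd_congr {Γ : Type*} [Group Γ] {a b a' b' : ℕ → Γ} {k : ℕ}
    (h : ∀ i < k, a i = a' i ∧ b i = b' i) : commProd a b k = commProd a' b' k := by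
  induction k with
  | zero => rfl
  | succ k ih =>
    rw [commProd, commProd, ih fun i hi => h i (by omega), (h k (by omega)).1, (h k (by omega)).2]

/-- Extension by one of a family indexed by `Fin g`. -/
def extendOne {Γ : Type*} [One Γ] {g : ℕ} (f : Fin g → Γ) (k : ℕ) : Γ :=
  if h : k < g then f ⟨k, h⟩ else 1

/-- The group with generators `a j, b j`, `j < g`, and the product of the commutators of `a j` and
`b j` as its only relator. -/
abbrev SurfaceGroup (g : ℕ) : Type :=
  PresentedGroup {commProd (extendOne fun j : Fin g => FreeGroup.of (j, false))
    (extendOne fun j : Fin g => FreeGroup.of (j, true)) g}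

namespace SurfaceGroup

variable {g : ℕ}

/-- The first generators. -/
def a (g : ℕ) : ℕ → SurfaceGroup g := extendOne fun j => PresentedGroup.of (j, false)

/-- The second generators. -/
def b (g : ℕ) : ℕ → SurfaceGroup g := extendOne fun j => PresentedGroup.of (j, true)

theorem map_extendOne {Γ Δ : Type*} [Group Γ] [Group Δ] (φ : Γ →* Δ) (f : Fin g → Γ) (k : ℕ) :
    φ (extendOne f k) = extendOne (fun j => φ (f j)) k := by
  unfold extendOne
  split_ifs <;> simp

theorem commProd_eq_one (g : ℕ) : commProd (a g) (b g) g = 1 := by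
  have := PresentedGroup.one_of_mem (rels := {commProd
    (extendOne fun j : Fin g => FreeGroup.of (j, false))
    (extendOne fun j : Fin g => FreeGroup.of (j, true)) g}) rfl
  rw [map_commProd] at this
  simp only [map_extendOne] at this
  exact this

/-- The universal property. -/
def lift {Γ : Type*} [Group Γ] (x y : ℕ → Γ) (h : commProd x y g = 1) : SurfaceGroup g →* Γ :=
  PresentedGroup.toGroup (f := fun i : Fin g × Bool => if i.2 then y i.1 else x i.1) (by
    rintro _ rfl
    rw [map_commProd, ← h]
    refine commProd_congr fun i hi => ?_
    simp [extendOne, hi])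

theorem lift_a {Γ : Type*} [Group Γ] (x y : ℕ → Γ) (h : commProd x y g = 1) {k : ℕ} (hk : k < g) :
    lift x y h (a g k) = x k := by
  simp [lift, a, extendOne, hk]

theorem lift_b {Γ : Type*} [Group Γ] (x y : ℕ → Γ) (h : commProd x y g = 1) {k : ℕ} (hk : k < g) :
    lift x y h (b g k) = y k := by
  simp [lift, b, extendOne, hk]

theorem closure_generators (g : ℕ) :
    Subgroup.closure {z | ∃ k < g, z = a g k ∨ z = b g k} = ⊤ := by
  rw [eq_top_iff, ← PresentedGroup.closure_range_of, Subgroup.closure_le]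
  rintro _ ⟨⟨j, _ | _⟩, rfl⟩
  · exact Subgroup.subset_closure ⟨j, j.2, Or.inl (by simp [a, extendOne])⟩
  · exact Subgroup.subset_closure ⟨j, j.2, Or.inr (by simp [b, extendOne])⟩

end SurfaceGroup

/-- The relation turns `[a₂, b₂]` into `[b₁, a₁]`, and the product of its conjugates by powers of
`a₁` telescopes. -/
theorem commProd_conj {Γ : Type*} [Group Γ] {a₁ b₁ a₂ b₂ : Γ}
    (h : a₁ * b₁ * a₁⁻¹ * b₁⁻¹ * (a₂ * b₂ * a₂⁻¹ * b₂⁻¹) = 1) (k : ℕ) :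
    commProd (fun i => a₁ ^ i * a₂ * (a₁ ^ i)⁻¹) (fun i => a₁ ^ i * b₂ * (a₁ ^ i)⁻¹) k =
      b₁ * a₁ ^ k * b₁⁻¹ * (a₁ ^ k)⁻¹ := by
  have h' : a₂ * b₂ * a₂⁻¹ * b₂⁻¹ = b₁ * a₁ * b₁⁻¹ * a₁⁻¹ := by
    rw [← inv_inj, eq_comm]
    simpa [mul_assoc] using eq_inv_of_mul_eq_one_left h
  induction k with
  | zero => simp [commProd]
  | succ k ih =>
    rw [commProd, ih]
    have : a₁ ^ k * a₂ * (a₁ ^ k)⁻¹ * (a₁ ^ k * b₂ * (a₁ ^ k)⁻¹) * (a₁ ^ k * a₂ * (a₁ ^ k)⁻¹)⁻¹ *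
        (a₁ ^ k * b₂ * (a₁ ^ k)⁻¹)⁻¹ = a₁ ^ k * (a₂ * b₂ * a₂⁻¹ * b₂⁻¹) * (a₁ ^ k)⁻¹ := by group
    rw [this, h']
    rw [pow_succ]
    group

/-- Elements of a cyclic cover of degree `n + 1` of the relation of genus two satisfy the relation
of genus `n + 2`. -/
theorem commProd_cyclicCover {Γ : Type*} [Group Γ] {a₁ b₁ a₂ b₂ : Γ}
    (h : a₁ * b₁ * a₁⁻¹ * b₁⁻¹ * (a₂ * b₂ * a₂⁻¹ * b₂⁻¹) = 1) (n : ℕ) :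
    commProd (fun i => if i < n + 1 then a₁ ^ i * a₂ * (a₁ ^ i)⁻¹ else a₁ ^ (n + 1))
      (fun i => if i < n + 1 then a₁ ^ i * b₂ * (a₁ ^ i)⁻¹ else b₁) (n + 2) = 1 := by
  rw [commProd, commProd_congr (a' := fun i => a₁ ^ i * a₂ * (a₁ ^ i)⁻¹)
    (b' := fun i => a₁ ^ i * b₂ * (a₁ ^ i)⁻¹), commProd_conj h]
  · simp only [lt_irrefl, if_false]
    group
  · intro i hi
    simp [hi]

section Permutations

variable {G : Type*} [Group G] {n : ℕ}

/-- The permutation of `Fin (n + 1) × G` translating the fibre over `i` by `d i`. -/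
def fibrePerm (d : Fin (n + 1) → G) : Equiv.Perm (Fin (n + 1) × G) where
  toFun x := (x.1, d x.1 * x.2)
  invFun x := (x.1, (d x.1)⁻¹ * x.2)
  left_inv x := by simp
  right_inv x := by simp

/-- The permutation of `Fin (n + 1) × G` shifting the first coordinate down, and translating by
`c` when wrapping around. -/
def shiftPerm (n : ℕ) (c : G) : Equiv.Perm (Fin (n + 1) × G) where
  toFun x := Fin.cases (Fin.last n, c * x.2) (fun j => (j.castSucc, x.2)) x.1
  invFun x := Fin.lastCases (0, c⁻¹ * x.2) (fun j => (j.succ, x.2)) x.1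
  left_inv := by
    rintro ⟨i, h⟩
    cases i using Fin.cases <;> simp
  right_inv := by
    rintro ⟨i, h⟩
    cases i using Fin.lastCases <;> simp

/-- The translations `(commProd a b i)⁻¹ * b (n + 1)` are obtained by solving this identity fibre by
fibre, starting from `b (n + 1)` over `0`. -/
theorem shiftPerm_conj_fibrePerm {a b : ℕ → G} (h : commProd a b (n + 2) = 1) :
    shiftPerm n (a (n + 1)) * fibrePerm (fun i => (commProd a b i)⁻¹ * b (n + 1)) *
      (shiftPerm n (a (n + 1)))⁻¹ *
      (fibrePerm (fun i : Fin (n + 1) => (commProd a b i)⁻¹ * b (n + 1)))⁻¹ =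
    fibrePerm (fun i => b i) * fibrePerm (fun i => a i) * (fibrePerm (fun i => b i))⁻¹ *
      (fibrePerm (fun i : Fin (n + 1) => a i))⁻¹ := by
  rw [mul_inv_eq_iff_eq_mul]
  have hinv (d : Fin (n + 1) → G) : (fibrePerm d)⁻¹ = fibrePerm (fun i => (d i)⁻¹) := by
    ext x <;> rfl
  simp only [hinv]
  ext1 ⟨i, x⟩
  have hs (y) : (shiftPerm n (a (n + 1)))⁻¹ y = (shiftPerm n (a (n + 1))).symm y := rfl
  simp only [Equiv.Perm.mul_apply, hs]
  cases i using Fin.lastCases with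
  | last =>
    simp [shiftPerm, fibrePerm]
    -- Wrapping around from the fibre over `0` closes the recursion exactly by the surface relation.
    have h' : (commProd a b (n + 1))⁻¹ =
        a (n + 1) * b (n + 1) * (a (n + 1))⁻¹ * (b (n + 1))⁻¹ := by
      rw [commProd] at h
      exact inv_eq_of_mul_eq_one_right h
    have h'' : a (n + 1) * b (n + 1) * (a (n + 1))⁻¹ =
        (commProd a b (n + 1))⁻¹ * b (n + 1) := by rw [h']; group
    have h0 : commProd a b 0 = 1 := rfl
    rw [← mul_assoc, ← mul_assoc, h0, inv_one, one_mul, h'', commProd]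
    group
  | cast j =>
    simp [shiftPerm, fibrePerm, commProd, mul_assoc]

end Permutations

/-- The universal property of the double of the free group. -/
def FreeDouble.lift {Q : Type*} [Group Q] (x₀ y₀ x₁ y₁ : Q)
    (h : x₀ * y₀ * x₀⁻¹ * y₀⁻¹ = x₁ * y₁ * x₁⁻¹ * y₁⁻¹) : FreeDouble →* Q :=
  Monoid.PushoutI.lift
    (fun i => FreeGroup.lift fun c : Bool => if i = 0 then (if c then y₀ else x₀) else
      (if c then y₁ else x₁))
    ((FreeGroup.lift fun c : Bool => if c then y₀ else x₀).comp
      (Subgroup.zpowers freeCommutator).subtype) (by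
      intro i
      ext ⟨c, hc⟩
      obtain ⟨k, rfl⟩ := Subgroup.mem_zpowers_iff.1 hc
      simp only [MonoidHom.comp_apply, Subgroup.subtype_apply, map_zpow]
      congr 1
      fin_cases i <;> simp [freeCommutator, h])

/-- The generators of the double of the free group. -/
def FreeDouble.gen (i : Fin 2) (c : Bool) : FreeDouble :=
  Monoid.PushoutI.of i (FreeGroup.of c)

theorem FreeDouble.lift_gen_zero {Q : Type*} [Group Q] (x₀ y₀ x₁ y₁ : Q)
    (h : x₀ * y₀ * x₀⁻¹ * y₀⁻¹ = x₁ * y₁ * x₁⁻¹ * y₁⁻¹) (c : Bool) :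
    FreeDouble.lift x₀ y₀ x₁ y₁ h (gen 0 c) = if c then y₀ else x₀ := by
  simp [FreeDouble.lift, gen]

theorem FreeDouble.lift_gen_one {Q : Type*} [Group Q] (x₀ y₀ x₁ y₁ : Q)
    (h : x₀ * y₀ * x₀⁻¹ * y₀⁻¹ = x₁ * y₁ * x₁⁻¹ * y₁⁻¹) (c : Bool) :
    FreeDouble.lift x₀ y₀ x₁ y₁ h (gen 1 c) = if c then y₁ else x₁ := by
  simp [FreeDouble.lift, gen]

theorem FreeDouble.gen_relation :
    gen 0 false * gen 0 true * (gen 0 false)⁻¹ * (gen 0 true)⁻¹ *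
      (gen 1 true * gen 1 false * (gen 1 true)⁻¹ * (gen 1 false)⁻¹) = 1 := by
  have h (i : Fin 2) : gen i false * gen i true * (gen i false)⁻¹ * (gen i true)⁻¹ =
      Monoid.PushoutI.base _ ⟨freeCommutator, Subgroup.mem_zpowers _⟩ := by
    rw [← Monoid.PushoutI.of_apply_eq_base _ i]
    simp only [gen, ← map_mul, ← map_inv]
    rfl
  rw [h 0, ← h 1]
  group

theorem shiftPerm_zero {G : Type*} [Group G] {n : ℕ} (c h : G) :
    shiftPerm n c (0, h) = (Fin.last n, c * h) := rfl

theorem shiftPerm_pow_of_le {G : Type*} [Group G] {n : ℕ} (c h : G) (k : ℕ) (hk : k ≤ n) :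
    (shiftPerm n c ^ k) (⟨k, by omega⟩, h) = (0, h) := by
  induction k with
  | zero => simp
  | succ k ih =>
    rw [pow_succ, Equiv.Perm.mul_apply, ← ih (by omega)]
    rfl

/-- Injectivity is detected by an action of the double on `n + 1` copies of `G`, modelled on the
induced action. Through `θ` the group `G` acts on the copy over `0` by left translation, which is
faithful. -/
theorem exists_surfaceGroup_injective_freeDouble (n : ℕ) :
    ∃ θ : SurfaceGroup (n + 2) →* FreeDouble, Function.Injective θ := by
  set G := SurfaceGroup (n + 2)
  set A := SurfaceGroup.a (n + 2)
  set B := SurfaceGroup.b (n + 2)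
  set θ : G →* FreeDouble := SurfaceGroup.lift _ _
    (commProd_cyclicCover FreeDouble.gen_relation n) with hθ
  set S := shiftPerm n (A (n + 1)) with hS
  -- The last two arguments come as `B`, then `A`: the double equates the commutators of its two
  -- copies, so the second pair is swapped to make their product trivial, as in
  -- `FreeDouble.gen_relation`.
  set Ψ : FreeDouble →* Equiv.Perm (Fin (n + 1) × G) := FreeDouble.lift
    S (fibrePerm fun i => (commProd A B i)⁻¹ * B (n + 1))
    (fibrePerm fun i => B i) (fibrePerm fun i => A i)
    (shiftPerm_conj_fibrePerm (SurfaceGroup.commProd_eq_one (n + 2))) with hΨ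
  have hpow (k : ℕ) (hk : k ≤ n) (h : G) : (S ^ k) (⟨k, by omega⟩, h) = (0, h) :=
    shiftPerm_pow_of_le _ h k hk
  have hpow' (k : ℕ) (hk : k ≤ n) (h : G) : (S ^ k)⁻¹ (0, h) = (⟨k, by omega⟩, h) := by
    rw [Equiv.Perm.inv_eq_iff_eq, hpow k hk]
  have hfibre (d : Fin (n + 1) → G) (k : ℕ) (hk : k ≤ n) (h : G) :
      (S ^ k * fibrePerm d * (S ^ k)⁻¹) (0, h) = (0, d ⟨k, by omega⟩ * h) := by
    rw [Equiv.Perm.mul_apply, Equiv.Perm.mul_apply, hpow' k hk]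
    exact hpow k hk _
  have key (x : G) : ∀ h : G, Ψ (θ x) (0, h) = (0, x * h) := by
    have hx : x ∈ Subgroup.closure {z | ∃ k < n + 2, z = A k ∨ z = B k} := by
      rw [SurfaceGroup.closure_generators]; trivial
    induction hx using Subgroup.closure_induction with
    | mem x hx =>
      intro h
      obtain ⟨k, hk, rfl | rfl⟩ := hx
      · rw [hθ, SurfaceGroup.lift_a _ _ _ hk]
        split_ifs with hkn
        · simp only [map_mul, map_inv, map_pow, hΨ, FreeDouble.lift_gen_zero,
            FreeDouble.lift_gen_one, if_true, Bool.false_eq_true, if_false]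
          exact hfibre _ k (by omega) h
        · obtain rfl : k = n + 1 := by omega
          simp only [map_pow, hΨ, FreeDouble.lift_gen_zero, Bool.false_eq_true, if_false]
          rw [pow_succ, Equiv.Perm.mul_apply, hS, shiftPerm_zero]
          exact hpow n le_rfl _
      · rw [hθ, SurfaceGroup.lift_b _ _ _ hk]
        split_ifs with hkn
        · simp only [map_mul, map_inv, map_pow, hΨ, FreeDouble.lift_gen_zero,
            FreeDouble.lift_gen_one, Bool.false_eq_true, if_false]
          exact hfibre _ k (by omega) h
        · obtain rfl : k = n + 1 := by omega
          simp only [hΨ, FreeDouble.lift_gen_zero, if_true]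
          simp [fibrePerm, commProd]
    | one => simp
    | mul x y _ _ hx hy =>
      intro h
      rw [map_mul, map_mul, Equiv.Perm.mul_apply, hy, hx, mul_assoc]
    | inv x _ hx =>
      intro h
      rw [map_inv, map_inv, Equiv.Perm.inv_eq_iff_eq, hx, mul_inv_cancel_left]
  refine ⟨θ, (injective_iff_map_eq_one θ).2 fun x hx => ?_⟩
  have := key x 1
  rw [hx, map_one] at this
  simpa using this.symm

end SurfaceGroup

/-! ### Descent to arbitrary fields of transcendence degree at least two. -/

section RationalFunctions

open IntermediateField in
theorem exists_ringHom_ratFunc_ratFunc {F K : Type*} [Field F] [Field K] [Algebra F K]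
    (h : 2 ≤ Algebra.trdeg F K) : Nonempty (RatFunc (RatFunc F) →+* K) := by
  obtain ⟨ι, x, hx⟩ := exists_isTranscendenceBasis' F K
  obtain ⟨i, j, hij⟩ : ∃ i j : ι, i ≠ j := by
    rw [← hx.cardinalMk_eq_trdeg, Cardinal.two_le_iff] at h
    exact h
  have hi : Transcendental F (x i) := hx.1.transcendental i
  let e := RatFunc.algEquivOfTranscendental (x i) hi
  have hj : Transcendental F⟮x i⟯ (x j) := by
    rw [IntermediateField.transcendental_adjoin_iff]
    have := hx.1.transcendental_adjoin (s := {i}) (i := j) (by simpa using hij.symm)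
    rwa [Set.image_singleton] at this
  let e' := RatFunc.algEquivOfTranscendental (x j) hj
  let m : RatFunc (RatFunc F) →+* RatFunc F⟮x i⟯ :=
    RatFunc.mapRingHom (Polynomial.mapRingHom (e : RatFunc F →+* F⟮x i⟯)) 
      (nonZeroDivisors_le_comap_nonZeroDivisors_of_injective _
        (Polynomial.map_injective _ e.injective))
  exact ⟨((algebraMap F⟮x i⟯⟮x j⟯ K).comp (e' : RatFunc F⟮x i⟯ →+* F⟮x i⟯⟮x j⟯)).comp m⟩

theorem exists_surfaceGroup_injective_GL (p : ℕ) [Fact p.Prime] (hp : 2 < p) {g : ℕ} (hg : 2 ≤ g)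
    (K : Type*) [Field K] [Algebra (ZMod p) K] (hK : 2 ≤ Algebra.trdeg (ZMod p) K) :
    ∃ R : SurfaceGroup g →* GL (Fin 2) K, Function.Injective R := by
  obtain ⟨n, rfl⟩ := Nat.exists_eq_add_of_le' hg
  obtain ⟨θ, hθ⟩ := exists_surfaceGroup_injective_freeDouble n
  obtain ⟨R, hR⟩ := exists_freeDouble_injective_ratFunc_ratFunc p hp
  obtain ⟨ι⟩ := exists_ringHom_ratFunc_ratFunc hK
  refine ⟨((Matrix.GeneralLinearGroup.map ι).comp R).comp θ, ?_⟩
  refine Function.Injective.comp (g := (Matrix.GeneralLinearGroup.map ι).comp R)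
    (fun f f' h => hR (Units.ext ?_)) hθ
  ext i j
  exact ι.injective (congrArg (fun M : GL (Fin 2) K => M.1 i j) h)

end RationalFunctions

/-! ### Coverings and monodromy of a space glued from a simply connected one. -/

section Gluing

open CategoryTheory Topology

/-- The map `q` exhibits `X` as the quotient of `D` by the relations `r e`, and the sets `U i` form
a cover of `D` by open sets saturated with respect to these relations. -/
structure IsGluing {D X E ι : Type*} [TopologicalSpace D] [TopologicalSpace X] (q : C(D, X))
    (r : E → D → D → Prop) (U : ι → Set D) : Prop where
  isQuotientMap : IsQuotientMap q
  eqvGen : ∀ z z', q z = q z' → Relation.EqvGen (fun z z' => ∃ e, r e z z') z z'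
  eq : ∀ e z z', r e z z' → q z = q z'
  isOpen : ∀ i, IsOpen (U i)
  cover : ∀ z, ∃ i, z ∈ U i
  mem_iff : ∀ i e z z', r e z z' → (z ∈ U i ↔ z' ∈ U i)

/-- The class of the image of any path from `z` to `w` in the simply connected space `D`. -/
noncomputable def imageHom {D X : Type*} [TopologicalSpace D] [TopologicalSpace X] [SimplyConnectedSpace D]
    (q : C(D, X)) (z w : D) : FundamentalGroupoid.mk (q z) ⟶ FundamentalGroupoid.mk (q w) :=
  (FundamentalGroupoid.map q).map (X := .mk z) (Y := .mk w)
    (Path.Homotopic.Quotient.mk (PathConnectedSpace.somePath z w))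

/-- The loop obtained by joining the base point to two points with the same image. -/
noncomputable def gluingLoop {D X : Type*} [TopologicalSpace D] [TopologicalSpace X] [SimplyConnectedSpace D]
    (q : C(D, X)) (z₀ : D) {z z' : D} (h : q z = q z') : FundamentalGroup X (q z₀) :=
  imageHom q z₀ z ≫ eqToHom congr(FundamentalGroupoid.mk $h) ≫ imageHom q z' z₀

universe u v

variable {D E ι : Type*} {X : Type u} [TopologicalSpace D] [TopologicalSpace X]
  {q : C(D, X)} {r : E → D → D → Prop} {U : ι → Set D}

theorem imageHom_eq [SimplyConnectedSpace D] {z w : D} (p : Path.Homotopic.Quotient z w) :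
    (FundamentalGroupoid.map q).map (X := .mk z) (Y := .mk w) p = imageHom q z w :=
  congrArg ((FundamentalGroupoid.map q).map (X := .mk z) (Y := .mk w))
    (Subsingleton.elim (α := Path.Homotopic.Quotient z w) _ _)

@[simp] theorem imageHom_self [SimplyConnectedSpace D] (z : D) : imageHom q z z = 𝟙 _ := by
  rw [← imageHom_eq (Path.Homotopic.Quotient.refl z)]
  rfl

@[simp] theorem imageHom_comp [SimplyConnectedSpace D] (z w u : D) :
    imageHom q z w ≫ imageHom q w u = imageHom q z u := by
  rw [← imageHom_eq (q := q) ((Path.Homotopic.Quotient.mk (PathConnectedSpace.somePath z w)).trans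
    (Path.Homotopic.Quotient.mk (PathConnectedSpace.somePath w u)))]
  exact ((FundamentalGroupoid.map q).map_comp (X := .mk z) (Y := .mk w) (Z := .mk u) _ _).symm

namespace IsGluing

theorem eq_of_eqvGen (h : IsGluing q r U) {z z' : D}
    (hz : Relation.EqvGen (fun z z' => ∃ e, r e z z') z z') : q z = q z' := by
  induction hz with
  | rel _ _ he => exact h.eq _ _ _ he.choose_spec
  | refl => rfl
  | symm _ _ _ ih => exact ih.symm
  | trans _ _ _ _ _ ih1 ih2 => exact ih1.trans ih2

/-- A function on `U i ∩ U j` respecting the relations respects equality of images. -/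
theorem eq_of_eq (h : IsGluing q r U) {α : Sort*} {f : D → α} (i j : ι)
    (hf : ∀ e z z', r e z z' → z ∈ U i → z ∈ U j → f z = f z') {z z' : D} (hz : q z = q z') :
    (z ∈ U i ↔ z' ∈ U i) ∧ (z ∈ U j ↔ z' ∈ U j) ∧ (z ∈ U i → z ∈ U j → f z = f z') := by
  have := h.eqvGen z z' hz
  clear hz
  induction this with
  | rel z z' he =>
    obtain ⟨e, he⟩ := he
    exact ⟨h.mem_iff i e z z' he, h.mem_iff j e z z' he, hf e z z' he⟩
  | refl => simp
  | symm z z' _ ih =>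
    exact ⟨ih.1.symm, ih.2.1.symm, fun h1 h2 => (ih.2.2 (ih.1.2 h1) (ih.2.1.2 h2)).symm⟩
  | trans z w z' _ _ ih1 ih2 =>
    exact ⟨ih1.1.trans ih2.1, ih1.2.1.trans ih2.2.1, fun h1 h2 =>
      (ih1.2.2 h1 h2).trans (ih2.2.2 (ih1.1.1 h1) (ih1.2.1.1 h2))⟩

theorem mem_iff_of_eq (h : IsGluing q r U) (i : ι) {z z' : D} (hz : q z = q z') :
    z ∈ U i ↔ z' ∈ U i :=
  (h.eq_of_eq (f := fun _ => ()) i i (fun _ _ _ _ _ _ => rfl) hz).1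

theorem preimage_image (h : IsGluing q r U) (i : ι) : q ⁻¹' (q '' U i) = U i := by
  ext z
  refine ⟨fun ⟨w, hw, hz⟩ => (h.mem_iff_of_eq i hz).1 hw, fun hz => ⟨z, hz, rfl⟩⟩

theorem mem_image_iff (h : IsGluing q r U) (i : ι) {z : D} : q z ∈ q '' U i ↔ z ∈ U i :=
  Set.ext_iff.1 (h.preimage_image i) z

theorem isOpen_image (h : IsGluing q r U) (i : ι) : IsOpen (q '' U i) := by
  rw [← h.isQuotientMap.isOpen_preimage, h.preimage_image]
  exact h.isOpen i

/-- The transition function between the coordinates given by two cochains. -/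
noncomputable def transition (h : IsGluing q r U) {G : Type*} [Group G] (s : ι → D → G) (i j : ι)
    (x : X) : G :=
  s j (Function.surjInv h.isQuotientMap.surjective x) *
    (s i (Function.surjInv h.isQuotientMap.surjective x))⁻¹

theorem transition_apply (h : IsGluing q r U) {G : Type*} [Group G] {x : E → G} {s : ι → D → G}
    (hs : ∀ i e z z', r e z z' → z ∈ U i → s i z' = s i z * x e) {i j : ι} {z : D}
    (hi : z ∈ U i) (hj : z ∈ U j) : h.transition s i j (q z) = s j z * (s i z)⁻¹ := by
  have hz : q z = q (Function.surjInv h.isQuotientMap.surjective (q z)) :=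
    (Function.surjInv_eq h.isQuotientMap.surjective _).symm
  exact ((h.eq_of_eq (f := fun z => s j z * (s i z)⁻¹) i j (fun e z z' he h1 h2 => by
    simp [hs i e z z' he h1, hs j e z z' he h2]) hz).2.2 hi hj).symm

theorem continuousOn_transition (h : IsGluing q r U) {G : Type*} [Group G] [TopologicalSpace G]
    [DiscreteTopology G] {x : E → G} {s : ι → D → G} (hsc : ∀ i, ContinuousOn (s i) (U i))
    (hs : ∀ i e z z', r e z z' → z ∈ U i → s i z' = s i z * x e) (i j : ι) :
    ContinuousOn (h.transition s i j) (q '' U i ∩ q '' U j) := by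
  rw [h.isQuotientMap.continuousOn_isOpen_iff ((h.isOpen_image i).inter (h.isOpen_image j)),
    Set.preimage_inter, h.preimage_image, h.preimage_image]
  refine ContinuousOn.congr (f := fun z => s j z * (s i z)⁻¹) ?_
    fun z hz => h.transition_apply hs hz.1 hz.2
  exact ((hsc j).mono Set.inter_subset_right).mul ((hsc i).mono Set.inter_subset_left).inv

/-- The covering space associated with a cocycle. -/
noncomputable def core (h : IsGluing q r U) {G : Type*} [Group G] [TopologicalSpace G]
    [DiscreteTopology G] {x : E → G} {s : ι → D → G} (hsc : ∀ i, ContinuousOn (s i) (U i))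
    (hs : ∀ i e z z', r e z z' → z ∈ U i → s i z' = s i z * x e) : FiberBundleCore ι X G where
  baseSet i := q '' U i
  isOpen_baseSet := h.isOpen_image
  indexAt y := (h.cover (Function.surjInv h.isQuotientMap.surjective y)).choose
  mem_baseSet_at y := ⟨_, (h.cover (Function.surjInv h.isQuotientMap.surjective y)).choose_spec,
    Function.surjInv_eq h.isQuotientMap.surjective y⟩
  coordChange i j y k := h.transition s i j y * k
  coordChange_self i := by
    rintro _ ⟨z, hz, rfl⟩ k
    simp [h.transition_apply hs hz hz]
  continuousOn_coordChange i j :=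
    ((h.continuousOn_transition hsc hs i j).comp continuousOn_fst fun _ hy => hy.1).mul
      continuousOn_snd
  coordChange_comp i j l := by
    rintro y ⟨⟨⟨z, hz, rfl⟩, hj⟩, hl⟩ k
    rw [h.mem_image_iff] at hj hl
    rw [h.transition_apply hs hz hj, h.transition_apply hs hz hl, h.transition_apply hs hj hl]
    group

section Monodromy

variable (h : IsGluing q r U) {G : Type*} [Group G] [TopologicalSpace G]
    [DiscreteTopology G] {x : E → G} {s : ι → D → G} (hsc : ∀ i, ContinuousOn (s i) (U i))
    (hs : ∀ i e z z', r e z z' → z ∈ U i → s i z' = s i z * x e)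

/-- The lifts of `q` to the covering space. -/
noncomputable def sheet (k : G) (z : D) : (h.core hsc hs).TotalSpace :=
  ⟨q z, s ((h.core hsc hs).indexAt (q z)) z * k⟩

theorem mem_indexAt (z : D) : z ∈ U ((h.core hsc hs).indexAt (q z)) :=
  (h.mem_image_iff _).1 ((h.core hsc hs).mem_baseSet_at (q z))

theorem continuous_sheet (k : G) : Continuous (h.sheet hsc hs k) := by
  rw [continuous_iff_continuousAt]
  intro z₀
  rw [FiberBundle.continuousAt_totalSpace]
  refine ⟨q.continuous.continuousAt, ?_⟩
  set i := (h.core hsc hs).indexAt (q z₀) with hi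
  have hz₀ : z₀ ∈ U i := h.mem_indexAt hsc hs z₀
  have hU : U i ∈ 𝓝 z₀ := (h.isOpen i).mem_nhds hz₀
  refine ContinuousAt.congr (f := fun z => s i z * k)
    (((hsc i).continuousAt hU).mul continuousAt_const) ?_
  filter_upwards [hU] with z hz
  change _ = h.transition s ((h.core hsc hs).indexAt (q z)) i (q z) * (s _ z * k)
  rw [h.transition_apply hs (h.mem_indexAt hsc hs z) hz]
  group

theorem sheet_eq_of_rel {e : E} {z z' : D} (hr : r e z z') (k : G) :
    h.sheet hsc hs k z = h.sheet hsc hs ((x e)⁻¹ * k) z' := by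
  have hz : q z = q z' := h.eq e z z' hr
  have hm := h.mem_indexAt hsc hs z
  unfold sheet
  rw [← hz, hs _ e z z' hr hm, mul_assoc, mul_inv_cancel_left]

end Monodromy

/-- The cocycle built from the cochains `s` defines a covering with fibre `G`, and each `k` gives a
lift of `q` to it, so paths in `D` stay in one sheet. Only the jump from `z` to `z'` changes the
sheet, from `k` to `(x e)⁻¹ * k`. -/
theorem exists_monodromy [SimplyConnectedSpace D] (h : IsGluing q r U) {G : Type v} [Group G]
    [TopologicalSpace G] [DiscreteTopology G] {x : E → G} {s : ι → D → G}
    (hsc : ∀ i, ContinuousOn (s i) (U i))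
    (hs : ∀ i e z z', r e z z' → z ∈ U i → s i z' = s i z * x e) (z₀ : D) :
    ∃ (Ω : Type (max u v)) (M : FundamentalGroup X (q z₀) →* Equiv.Perm Ω)
    (Λ : G → Ω), Function.Injective Λ ∧ ∀ e z z', r e z z' → ∀ (hz : q z = q z') (k : G),
      M (gluingLoop q z₀ hz) (Λ k) = Λ ((x e)⁻¹ * k) := by
  set Z := h.core hsc hs
  have hcov : IsCoveringMap Z.proj := FiberBundle.isCoveringMap (F := G) (E := Z.Fiber)
  let Λ (k : G) (z : D) : Z.proj ⁻¹' {q z} := ⟨h.sheet hsc hs k z, rfl⟩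
  have hΛ (k : G) (z w : D) : hcov.monodromy (imageHom q z w) (Λ k z) = Λ k w := by
    let P : Path (h.sheet hsc hs k z) (h.sheet hsc hs k w) :=
      (PathConnectedSpace.somePath z w).map (h.continuous_sheet hsc hs k)
    refine hcov.monodromy_eq_of_map_eq (ex := Λ k z) (ey := Λ k w)
      (Path.Homotopic.Quotient.mk P) ?_
    rfl
  have hcast (x y : X) (hxy : x = y) (e : Z.proj ⁻¹' {x}) :
      (hcov.monodromy (eqToHom congr(FundamentalGroupoid.mk $hxy)) e : Z.TotalSpace) = e := by
    subst hxy
    exact congrArg Subtype.val (congrFun hcov.monodromy_refl e)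
  refine ⟨_, hcov.monodromyPerm (q z₀), fun k => Λ k z₀, ?_, ?_⟩
  · intro k k' hk
    have h1 := congrArg (fun e => e.1.2) hk
    exact mul_left_cancel h1
  · intro e z z' hr hz k
    have h1 := hcov.monodromy_trans_apply (imageHom q z₀ z)
      (eqToHom congr(FundamentalGroupoid.mk $hz) ≫ imageHom q z' z₀) (Λ k z₀)
    have h2 := hcov.monodromy_trans_apply (eqToHom congr(FundamentalGroupoid.mk $hz))
      (imageHom q z' z₀) (Λ k z)
    have h3 : hcov.monodromy (eqToHom congr(FundamentalGroupoid.mk $hz)) (Λ k z) =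
        Λ ((x e)⁻¹ * k) z' :=
      Subtype.ext ((hcast _ _ hz _).trans (h.sheet_eq_of_rel hsc hs hr k))
    rw [hΛ] at h1
    rw [h3, hΛ] at h2
    exact h1.trans h2

end IsGluing

end Gluing

/-! ### Gluing loops generate the fundamental group. -/

section Generation

open CategoryTheory Topology unitInterval

universe u

variable {D E ι : Type*} {X : Type u} [TopologicalSpace D] [TopologicalSpace X]
  [SimplyConnectedSpace D] {q : C(D, X)} {r : E → D → D → Prop} {U : ι → Set D}

/-- The loop obtained from a homotopy class of paths by joining the base point to points over the
endpoints belongs to the subgroup `H`. -/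
def ClosesUpIn {z₀ : D} (H : Subgroup (FundamentalGroup X (q z₀))) {x y : X} (P : Path x y) :
    Prop :=
  ∀ (z w : D) (hz : q z = x) (hw : y = q w),
    (imageHom q z₀ z ≫ eqToHom congr(FundamentalGroupoid.mk $hz) ≫
      (Path.Homotopic.Quotient.mk P : FundamentalGroupoid.mk x ⟶ FundamentalGroupoid.mk y) ≫
      eqToHom congr(FundamentalGroupoid.mk $hw) ≫ imageHom q w z₀ :
        FundamentalGroup X (q z₀)) ∈ H

@[simp] theorem imageHom_comp_assoc (z w u : D) {y : FundamentalGroupoid X}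
    (f : FundamentalGroupoid.mk (q u) ⟶ y) :
    imageHom q z w ≫ imageHom q w u ≫ f = imageHom q z u ≫ f := by
  rw [← Category.assoc, imageHom_comp]

theorem gluingLoop_symm (z₀ : D) {z z' : D} (h : q z = q z') :
    gluingLoop q z₀ h.symm = (gluingLoop q z₀ h)⁻¹ := by
  rw [eq_inv_iff_mul_eq_one]
  change (_ ≫ _ ≫ _) ≫ (_ ≫ _ ≫ _) = 𝟙 _
  simp

/-- The product of the fundamental group runs through its right factor first, hence the reversed
order. -/
theorem gluingLoop_trans (z₀ : D) {z w z' : D} (h : q z = q w) (h' : q w = q z') :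
    gluingLoop q z₀ (h.trans h') = gluingLoop q z₀ h' * gluingLoop q z₀ h := by
  change _ = (_ ≫ _ ≫ _) ≫ (_ ≫ _ ≫ _)
  simp [gluingLoop]

theorem mk_comp_eqToHom {x y x' y' : X} (P : Path x y) (P' : Path x' y') (h : ∀ t, P t = P' t)
    (hx : x = x') (hy : y = y') :
    (Path.Homotopic.Quotient.mk P : FundamentalGroupoid.mk x ⟶ FundamentalGroupoid.mk y) ≫
      eqToHom congr(FundamentalGroupoid.mk $hy) =
    eqToHom congr(FundamentalGroupoid.mk $hx) ≫
      (Path.Homotopic.Quotient.mk P' :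
        FundamentalGroupoid.mk x' ⟶ FundamentalGroupoid.mk y') := by
  subst hx hy
  obtain rfl : P = P' := Path.ext (funext h)
  simp

/-- Sliding a pair of glued points along paths that remain glued does not change the loop. -/
theorem gluingLoop_eq_of_path (z₀ : D) {z w z' w' : D} (P : Path z w) (P' : Path z' w')
    (h : ∀ t, q (P t) = q (P' t)) (hz : q z = q z') (hw : q w = q w') :
    gluingLoop q z₀ hz = gluingLoop q z₀ hw := by
  have h1 := mk_comp_eqToHom (P.map q.continuous) (P'.map q.continuous) h hz hw
  have h2 : (Path.Homotopic.Quotient.mk (P.map q.continuous) :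
      FundamentalGroupoid.mk (q z) ⟶ FundamentalGroupoid.mk (q w)) = imageHom q z w :=
    imageHom_eq (q := q) (Path.Homotopic.Quotient.mk P)
  have h3 : (Path.Homotopic.Quotient.mk (P'.map q.continuous) :
      FundamentalGroupoid.mk (q z') ⟶ FundamentalGroupoid.mk (q w')) = imageHom q z' w' :=
    imageHom_eq (q := q) (Path.Homotopic.Quotient.mk P')
  rw [h2, h3] at h1
  rw [gluingLoop, gluingLoop, ← imageHom_comp z' w' z₀, ← imageHom_comp z₀ z w, Category.assoc,
    reassoc_of% h1]

theorem IsGluing.gluingLoop_mem (h : IsGluing q r U) {z₀ : D}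
    {H : Subgroup (FundamentalGroup X (q z₀))}
    (hH : ∀ e z z', r e z z' → ∀ hz : q z = q z', gluingLoop q z₀ hz ∈ H) {z z' : D}
    (hz : q z = q z') : gluingLoop q z₀ hz ∈ H := by
  have key : ∀ hz : q z = q z', gluingLoop q z₀ hz ∈ H := by
    have := h.eqvGen z z' hz
    clear hz
    induction this with
    | rel z z' he => exact hH _ z z' he.choose_spec
    | refl z =>
      intro hz
      have : gluingLoop q z₀ hz = 1 := by
        simp [gluingLoop]
      rw [this]
      exact H.one_mem
    | symm z z' _ ih =>
      intro hz
      rw [gluingLoop_symm z₀ hz.symm]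
      exact H.inv_mem (ih hz.symm)
    | trans z w z' h1 _ ih1 ih2 =>
      intro hz
      have hzw : q z = q w := h.eq_of_eqvGen h1
      rw [gluingLoop_trans z₀ hzw (hzw.symm.trans hz)]
      exact H.mul_mem (ih2 _) (ih1 _)
  exact key hz

namespace ClosesUpIn

variable {z₀ : D} {H : Subgroup (FundamentalGroup X (q z₀))}

theorem congr {x y x' y' : X} {P : Path x y} {P' : Path x' y'} (hP : ClosesUpIn H P)
    (h : ∀ t, P t = P' t) : ClosesUpIn H P' := by
  obtain rfl : x = x' := by simpa using h 0
  obtain rfl : y = y' := by simpa using h 1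
  obtain rfl : P = P' := Path.ext (funext h)
  exact hP

theorem of_homotopic {x y : X} {P P' : Path x y} (hP : ClosesUpIn H P)
    (h : P.Homotopic P') : ClosesUpIn H P' := by
  intro z w hz hw
  have := hP z w hz hw
  rwa [show Path.Homotopic.Quotient.mk P = Path.Homotopic.Quotient.mk P' from
    Path.Homotopic.Quotient.eq.2 h] at this

theorem map (hH : ∀ (z z' : D) (hz : q z = q z'), gluingLoop q z₀ hz ∈ H) {z w : D}
    (P : Path z w) : ClosesUpIn H (P.map q.continuous) := by
  intro z' w' hz hw
  have h1 : (Path.Homotopic.Quotient.mk (P.map q.continuous) :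
      FundamentalGroupoid.mk (q z) ⟶ FundamentalGroupoid.mk (q w)) = imageHom q z w :=
    imageHom_eq (q := q) (Path.Homotopic.Quotient.mk P)
  rw [h1]
  have h2 : (imageHom q z₀ z' ≫ eqToHom congr(FundamentalGroupoid.mk $hz) ≫ imageHom q z w ≫
      eqToHom congr(FundamentalGroupoid.mk $hw) ≫ imageHom q w' z₀ : FundamentalGroup X (q z₀)) =
      gluingLoop q z₀ hw * gluingLoop q z₀ hz := by
    change _ = (_ ≫ _ ≫ _) ≫ (_ ≫ _ ≫ _)
    simp
  rw [h2]
  exact H.mul_mem (hH _ _ _) (hH _ _ _)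

theorem trans (hq : Function.Surjective q) {x y y' : X} {P : Path x y} {Q : Path y y'}
    (hP : ClosesUpIn H P) (hQ : ClosesUpIn H Q) : ClosesUpIn H (P.trans Q) := by
  intro z w hz hw
  obtain ⟨u, rfl⟩ := hq y
  have := H.mul_mem (hQ u w rfl hw) (hP z u hz rfl)
  refine (congrArg (· ∈ H) ?_).mp this
  change (_ ≫ _ ≫ _ ≫ _ ≫ _) ≫ (_ ≫ _ ≫ _ ≫ _ ≫ _) = _
  rw [Path.Homotopic.Quotient.mk_trans]
  change _ = _ ≫ _ ≫ (_ ≫ _) ≫ _ ≫ _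
  simp

theorem of_trans (hq : Function.Surjective q) {x y y' : X} {P : Path x y} {Q : Path y y'}
    (hP : ClosesUpIn H (P.trans Q)) (hQ : ClosesUpIn H Q) : ClosesUpIn H P := by
  intro z w hz hw
  obtain ⟨u, rfl⟩ := hq y'
  refine (H.mul_mem_cancel_left (hQ w u hw.symm rfl)).1 ?_
  refine (congrArg (· ∈ H) ?_).mp (hP z u hz rfl)
  change _ = (_ ≫ _ ≫ _ ≫ _ ≫ _) ≫ (_ ≫ _ ≫ _ ≫ _ ≫ _)
  rw [Path.Homotopic.Quotient.mk_trans]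
  change _ ≫ _ ≫ (_ ≫ _) ≫ _ ≫ _ = _
  simp

end ClosesUpIn

/-- A deformation of the open set `V ⊆ D`, compatible with the relations, whose end map is locally
constant. -/
structure IsCollapse (q : C(D, X)) (r : E → D → D → Prop) (V : Set D) (C : D × I → D) : Prop where
  continuousOn : ContinuousOn C (V ×ˢ Set.univ)
  zero : ∀ z ∈ V, C (z, 0) = z
  compat : ∀ e z z' t, r e z z' → z ∈ V → q (C (z, t)) = q (C (z', t))
  one : ∀ z ∈ V, ∀ᶠ w in 𝓝 z, C (w, 1) = C (z, 1)

namespace IsGluing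

/-- The collapse descends to a homotopy from the inclusion of the chart to a locally constant map.
Hence `P` followed by the track of its endpoint is homotopic to the track of its starting point
followed by a constant path. The tracks are images of paths in `D`, so they close up in `H`. -/
theorem closesUpIn_of_range_subset (h : IsGluing q r U) {z₀ : D}
    {H : Subgroup (FundamentalGroup X (q z₀))}
    (hH : ∀ (z z' : D) (hz : q z = q z'), gluingLoop q z₀ hz ∈ H) {i : ι} {C : D × I → D}
    (hC : IsCollapse q r (U i) C) {x y : X} (P : Path x y) (hP : ∀ t, P t ∈ q '' U i) :
    ClosesUpIn H P := by
  set V := q '' U i with hV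
  have hqs := h.isQuotientMap.surjective
  let f : C(V, X) := ⟨Subtype.val, continuous_subtype_val⟩
  have hinv (z : D) (hz : z ∈ U i) (t : I) :
      q (C (Function.surjInv hqs (q z), t)) = q (C (z, t)) :=
    ((h.eq_of_eq (f := fun z => q (C (z, t))) i i (fun e z z' hr hz _ => hC.compat e z z' t hr hz)
      (Function.surjInv_eq hqs (q z)).symm).2.2 hz hz).symm
  have hqV : IsQuotientMap (V.restrictPreimage q) :=
    h.isQuotientMap.restrictPreimage_isOpen (h.isOpen_image i)
  have hmem (z : q ⁻¹' V) : z.1 ∈ U i := (h.mem_image_iff i).1 z.2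
  have hcont : Continuous fun p : V × I => q (C (Function.surjInv hqs p.1, p.2)) := by
    -- The product of a quotient map with the unit interval is again a quotient map.
    refine hqV.continuous_lift_prod_left ?_
    refine Continuous.congr (f := fun p : (q ⁻¹' V) × I => q (C (p.1.1, p.2))) ?_
      fun p => (hinv p.1.1 (hmem p.1) p.2).symm
    exact q.continuous.comp (hC.continuousOn.comp_continuous (by fun_prop) fun p => ⟨hmem p.1, trivial⟩)
  let g : C(V, X) := ⟨fun v => q (C (Function.surjInv hqs v, 1)), hcont.comp (by fun_prop : Continuous fun v : V => (v, (1 : I)))⟩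
  let F : f.Homotopy g :=
    { toFun := fun p => q (C (Function.surjInv hqs p.2, p.1))
      continuous_toFun := hcont.comp continuous_swap
      map_zero_left := by
        rintro ⟨_, z, hz, rfl⟩
        exact (hinv z hz 0).trans (congrArg q (hC.zero z hz))
      map_one_left := fun v => rfl }
  let P' : Path (⟨x, by simpa using hP 0⟩ : V) ⟨y, by simpa using hP 1⟩ :=
    { toFun := fun t => ⟨P t, hP t⟩
      source' := by simp
      target' := by simp }
  have hF (v : V) : ClosesUpIn H (F.evalAt v) := by
    obtain ⟨_, z, hz, rfl⟩ := v
    let Q : Path (C (z, 0)) (C (z, 1)) :=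
      { toFun := fun t => C (z, t)
        continuous_toFun := hC.continuousOn.comp_continuous (by fun_prop) fun p => ⟨hz, trivial⟩
        source' := rfl
        target' := rfl }
    exact (ClosesUpIn.map hH Q).congr fun t => (hinv z hz t).symm
  have hg : IsLocallyConstant g := by
    rw [IsLocallyConstant.iff_isOpen_fiber]
    intro y
    rw [← hqV.isOpen_preimage, isOpen_iff_mem_nhds]
    intro z hz
    filter_upwards [continuousAt_subtype_val.eventually (hC.one z.1 (hmem z))] with w hw
    exact ((hinv w.1 (hmem w) 1).trans (congrArg q hw)).trans
      ((hinv z.1 (hmem z) 1).symm.trans hz)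
  have hconst : ClosesUpIn H (P'.map (map_continuous g)) := by
    obtain ⟨z, hz⟩ := hqs (g (P' 0))
    refine (ClosesUpIn.map hH (Path.refl z)).congr fun t => ?_
    exact hz.trans ((hg.comp_continuous P'.continuous).apply_eq_of_isPreconnected
      isPreconnected_univ (Set.mem_univ _) (Set.mem_univ _))
  have h1 : ClosesUpIn H ((P'.map (map_continuous f)).trans (F.evalAt _)) :=
    ((hF _).trans hqs hconst).of_homotopic (Path.Homotopic.map_trans_evalAt F P').symm
  exact (h1.of_trans hqs (hF _)).congr fun t => rfl

/-- A subdivision of the unit interval cuts any path into pieces lying in single charts. -/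
theorem eq_top_of_forall_gluingLoop_mem (h : IsGluing q r U) {z₀ : D}
    {H : Subgroup (FundamentalGroup X (q z₀))}
    (hH : ∀ e z z', r e z z' → ∀ hz : q z = q z', gluingLoop q z₀ hz ∈ H)
    (hC : ∀ i, ∃ C : D × I → D, IsCollapse q r (U i) C) : H = ⊤ := by
  have hqs := h.isQuotientMap.surjective
  have hH' (z z' : D) (hz : q z = q z') := h.gluingLoop_mem hH hz
  have key {x y : X} (P : Path x y) : ClosesUpIn H P := by
    obtain ⟨t, ht0, htm, ⟨n, hn⟩, ht⟩ := exists_monotone_Icc_subset_open_cover_unitInterval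
      (c := fun i => P ⁻¹' (q '' U i)) (fun i => (h.isOpen_image i).preimage P.continuous) (by
        intro s _
        obtain ⟨z, hz⟩ := hqs (P s)
        obtain ⟨i, hi⟩ := h.cover z
        exact Set.mem_iUnion.2 ⟨i, z, hi, hz⟩)
    have hsub (m : ℕ) : ClosesUpIn H (P.subpath (t 0) (t m)) := by
      induction m with
      | zero =>
        obtain ⟨z, hz⟩ := hqs (P (t 0))
        exact (ClosesUpIn.map hH' (Path.refl z)).congr fun s => by simp [hz]
      | succ m ih =>
        obtain ⟨i, hi⟩ := ht m
        obtain ⟨C, hC⟩ := hC i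
        refine (ih.trans hqs (h.closesUpIn_of_range_subset hH' hC
          (P.subpath (t m) (t (m + 1))) fun s => ?_)).of_homotopic
            ⟨Path.Homotopy.subpathTransSubpath P _ _ _⟩
        have h1 := Set.mem_range_self (f := P.subpath (t m) (t (m + 1))) s
        rw [P.range_subpath_of_le _ _ (htm (Nat.le_succ m))] at h1
        obtain ⟨a, ha, hPa⟩ := h1
        rw [← hPa]
        exact hi ha
    refine (hsub n).congr fun s => ?_
    rw [ht0, hn n le_rfl, Path.subpath_zero_one]
    rfl
  rw [eq_top_iff]
  intro γ _
  obtain ⟨P, rfl⟩ := Path.Homotopic.Quotient.mk_surjective γ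
  have := key P z₀ z₀ rfl rfl
  simpa using this

end IsGluing

end Generation

/-! ### Charts of the polygon: interior, vertex sectors and edge sectors. -/

section SurfaceCharts

open CategoryTheory Topology unitInterval

theorem boundaryPoint_eq_iff {g : ℕ} (hg : 0 < g) {x y : ℝ} :
    boundaryPoint g x = boundaryPoint g y ↔ ∃ m : ℤ, x = y + 4 * g * m := by
  have hg' : (g : ℝ) ≠ 0 := by positivity
  have hπ := Real.pi_ne_zero
  rw [Subtype.ext_iff]
  change Complex.exp _ = Complex.exp _ ↔ _
  rw [Complex.exp_eq_exp_iff_exists_int]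
  refine exists_congr fun m => ?_
  rw [show (m : ℂ) * (2 * Real.pi * Complex.I) = ((m * (2 * Real.pi) : ℝ) : ℂ) * Complex.I by
    push_cast; ring, ← add_mul, mul_left_inj' Complex.I_ne_zero, ← Complex.ofReal_add,
    Complex.ofReal_inj]
  field_simp

theorem boundaryPoint_add_mul_int {g : ℕ} (hg : 0 < g) (x : ℝ) (m : ℤ) :
    boundaryPoint g (x + 4 * g * m) = boundaryPoint g x :=
  (boundaryPoint_eq_iff hg).2 ⟨m, rfl⟩

theorem norm_boundaryPoint (g : ℕ) (x : ℝ) : ‖(boundaryPoint g x : ℂ)‖ = 1 :=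
  Complex.norm_exp_ofReal_mul_I _

theorem continuous_boundaryPoint (g : ℕ) : Continuous (boundaryPoint g) := by
  unfold boundaryPoint
  fun_prop

theorem boundaryPoint_add_val (g : ℕ) (x y : ℝ) :
    (boundaryPoint g (x + y) : ℂ) = boundaryPoint g x * boundaryPoint g y := by
  change Complex.exp _ = Complex.exp _ * Complex.exp _
  rw [← Complex.exp_add]
  congr 1
  push_cast
  ring

/-- The angular coordinate whose branch cut is at `δ - 1 / 2`. -/
noncomputable def angularPosition (g : ℕ) (δ : ℝ) (z : ℂ) : ℝ :=
  2 * g + δ - 1 / 2 + 2 * g / Real.pi * (z * boundaryPoint g (-(2 * g + δ - 1 / 2))).arg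

/-- The union of the open sectors of angular width one around the positions in `δ + ℤ`. -/
def sectors (g : ℕ) (δ : ℝ) : Set (Metric.closedBall (0 : ℂ) 1) :=
  {z | (z : ℂ) ≠ 0 ∧ ∀ n : ℤ, angularPosition g δ z ≠ n + δ + 1 / 2}

/-- The number of the sector containing a point. -/
noncomputable def sectorIndex (g : ℕ) (δ : ℝ) (z : Metric.closedBall (0 : ℂ) 1) : ℤ :=
  ⌊angularPosition g δ z - δ + 1 / 2⌋

/-- The point of the disc with given polar coordinates. -/
noncomputable def polarPoint (g : ℕ) (ρ : I) (s : ℝ) : Metric.closedBall (0 : ℂ) 1 :=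
  ⟨((ρ : ℝ) : ℂ) * boundaryPoint g s, by
    rw [mem_closedBall_zero_iff, norm_mul, norm_boundaryPoint, mul_one, Complex.norm_real,
      Real.norm_of_nonneg ρ.2.1]
    exact ρ.2.2⟩

/-- The distance to the centre. -/
noncomputable def radius (z : Metric.closedBall (0 : ℂ) 1) : I :=
  ⟨‖(z : ℂ)‖, norm_nonneg _, mem_closedBall_zero_iff.1 z.2⟩

variable {g : ℕ}

theorem polarPoint_one (s : ℝ) : polarPoint g 1 s = boundaryPoint g s :=
  Subtype.ext (by simp [polarPoint])

theorem radius_boundaryPoint (s : ℝ) : radius (boundaryPoint g s) = 1 :=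
  Subtype.ext (norm_boundaryPoint g s)

theorem continuous_radius : Continuous radius := by
  unfold radius
  fun_prop

theorem continuous_polarPoint : Continuous fun p : I × ℝ => polarPoint g p.1 p.2 := by
  have := continuous_boundaryPoint g
  unfold polarPoint
  fun_prop

theorem polarPoint_radius (hg : 0 < g) (δ : ℝ) (z : Metric.closedBall (0 : ℂ) 1) :
    polarPoint g (radius z) (angularPosition g δ z) = z := by
  have hg' : (g : ℝ) ≠ 0 := by positivity
  have hπ := Real.pi_ne_zero
  apply Subtype.ext
  change (‖(z : ℂ)‖ : ℂ) * _ = _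
  set c : ℝ := 2 * g + δ - 1 / 2
  set w : ℂ := z * boundaryPoint g (-c) with hw
  have h1 : w = ‖(z : ℂ)‖ * Complex.exp (w.arg * Complex.I) := by
    rw [show ‖(z : ℂ)‖ = ‖w‖ by rw [hw, norm_mul, norm_boundaryPoint, mul_one],
      Complex.norm_mul_exp_arg_mul_I]
  have h2 : (boundaryPoint g (2 * g / Real.pi * w.arg) : ℂ) = Complex.exp (w.arg * Complex.I) := by
    change Complex.exp _ = _
    congr 3
    field_simp
    ring
  have h3 : (boundaryPoint g (-c) : ℂ) * boundaryPoint g c = 1 := by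
    rw [← boundaryPoint_add_val]
    simp [boundaryPoint]
  calc (‖(z : ℂ)‖ : ℂ) * (boundaryPoint g (c + 2 * g / Real.pi * w.arg) : ℂ)
      = w * boundaryPoint g c := by
        rw [boundaryPoint_add_val, h2]
        linear_combination -(boundaryPoint g c : ℂ) * h1
    _ = z := by rw [hw, mul_assoc, h3, mul_one]

theorem angularPosition_boundaryPoint (hg : 0 < g) (δ s : ℝ) :
    ∃ m : ℤ, angularPosition g δ (boundaryPoint g s) = s + 4 * g * m := by
  rw [← boundaryPoint_eq_iff hg, ← polarPoint_one, ← radius_boundaryPoint (g := g) s,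
    polarPoint_radius hg]

theorem continuousAt_angularPosition {δ : ℝ} {z : Metric.closedBall (0 : ℂ) 1}
    (hz : z ∈ sectors g δ) : ContinuousAt (angularPosition g δ) z := by
  have hπ := Real.pi_ne_zero
  unfold angularPosition
  refine continuousAt_const.add (continuousAt_const.mul
    (ContinuousAt.comp (g := Complex.arg) (Complex.continuousAt_arg ?_)
      (continuousAt_id.mul continuousAt_const)))
  rw [Complex.mem_slitPlane_iff_arg]
  -- The branch cut is itself a boundary ray of the sectors: argument `π` gives the position `4 * g
  -- + δ - 1 / 2`.
  refine ⟨fun h => hz.2 (4 * g - 1) ?_, mul_ne_zero hz.1 ?_⟩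
  · rw [angularPosition]
    erw [h]
    push_cast
    field_simp
    ring
  · exact norm_ne_zero_iff.1 (by simp [norm_boundaryPoint])

theorem abs_sub_sectorIndex_lt {δ : ℝ} {z : Metric.closedBall (0 : ℂ) 1} (hz : z ∈ sectors g δ) :
    |angularPosition g δ z - (sectorIndex g δ z + δ)| < 1 / 2 := by
  have h1 := Int.floor_le (angularPosition g δ z - δ + 1 / 2)
  have h2 := Int.lt_floor_add_one (angularPosition g δ z - δ + 1 / 2)
  have h3 := hz.2 (sectorIndex g δ z - 1)
  change ((sectorIndex g δ z : ℤ) : ℝ) ≤ _ at h1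
  change _ < ((sectorIndex g δ z : ℤ) : ℝ) + 1 at h2
  push_cast at h3
  rw [abs_lt]
  refine ⟨lt_of_le_of_ne (by linarith) fun h => h3 (by linarith), by linarith⟩

theorem mem_sectors_of_abs_lt {δ : ℝ} {z : Metric.closedBall (0 : ℂ) 1} (h0 : (z : ℂ) ≠ 0) {n : ℤ}
    (hz : |angularPosition g δ z - (n + δ)| < 1 / 2) :
    z ∈ sectors g δ ∧ sectorIndex g δ z = n := by
  rw [abs_lt] at hz
  refine ⟨⟨h0, fun m hm => ?_⟩, ?_⟩
  · have h1 : (m : ℝ) < n := by linarith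
    have h2 : (n : ℝ) < m + 1 := by linarith
    norm_cast at h1 h2
    omega
  · rw [sectorIndex, Int.floor_eq_iff]
    constructor <;> linarith

theorem eventually_sectorIndex_eq {δ : ℝ} {z : Metric.closedBall (0 : ℂ) 1}
    (hz : z ∈ sectors g δ) :
    ∀ᶠ w in 𝓝 z, w ∈ sectors g δ ∧ sectorIndex g δ w = sectorIndex g δ z := by
  have h1 : ContinuousAt (fun w : Metric.closedBall (0 : ℂ) 1 => angularPosition g δ w) z :=
    (continuousAt_angularPosition hz).comp continuousAt_subtype_val
  have h2 : ContinuousAt (fun w : Metric.closedBall (0 : ℂ) 1 =>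
      |angularPosition g δ w - (sectorIndex g δ z + δ)|) z := (h1.sub continuousAt_const).abs
  filter_upwards [h2.eventually (gt_mem_nhds (abs_sub_sectorIndex_lt hz)),
    continuousAt_subtype_val.eventually (isOpen_ne.mem_nhds hz.1)] with w hw hw0
  exact mem_sectors_of_abs_lt hw0 hw

theorem isOpen_sectors (δ : ℝ) : IsOpen (sectors g δ) :=
  isOpen_iff_mem_nhds.2 fun _ hz => (eventually_sectorIndex_eq hz).mono fun _ h => h.1

theorem boundaryPoint_ne_zero (s : ℝ) : (boundaryPoint g s : ℂ) ≠ 0 :=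
  norm_ne_zero_iff.1 (by simp [norm_boundaryPoint])

theorem boundaryPoint_mem_sectors_iff (hg : 0 < g) {δ s : ℝ} :
    boundaryPoint g s ∈ sectors g δ ↔ ∀ n : ℤ, s ≠ n + δ + 1 / 2 := by
  obtain ⟨m, hm⟩ := angularPosition_boundaryPoint hg δ s
  refine ⟨fun h n hn => h.2 (n + 4 * g * m) ?_, fun h => ⟨boundaryPoint_ne_zero s,
    fun n hn => h (n - 4 * g * m) ?_⟩⟩
  · rw [hm, hn]
    push_cast
    ring
  · rw [hm] at hn
    push_cast
    linarith

theorem sectorIndex_boundaryPoint (hg : 0 < g) {δ s : ℝ} {n : ℤ} (hs : |s - (n + δ)| < 1 / 2) :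
    ∃ m : ℤ, angularPosition g δ (boundaryPoint g s) = s + 4 * g * m ∧
      sectorIndex g δ (boundaryPoint g s) = n + 4 * g * m := by
  obtain ⟨m, hm⟩ := angularPosition_boundaryPoint hg δ s
  refine ⟨m, hm, (mem_sectors_of_abs_lt (boundaryPoint_ne_zero s) ?_).2⟩
  rw [hm]
  push_cast
  convert hs using 2
  ring

/-- The deformation of the sectors onto the boundary points at the positions in `δ + ℤ`. -/
noncomputable def sectorCollapse (g : ℕ) (δ : ℝ) (p : Metric.closedBall (0 : ℂ) 1 × I) :
    Metric.closedBall (0 : ℂ) 1 :=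
  -- The radius at time `τ` is `1 - (1 - τ) * (1 - r)`, growing from `r` to `1`, while the angle
  -- moves linearly to the centre of its sector.
  polarPoint g (σ (σ p.2 * σ (radius p.1)))
    (sectorIndex g δ p.1 + δ + σ p.2 * (angularPosition g δ p.1 - (sectorIndex g δ p.1 + δ)))

theorem sectorCollapse_boundaryPoint (hg : 0 < g) {δ s : ℝ} {n : ℤ} (hs : |s - (n + δ)| < 1 / 2)
    (τ : I) : sectorCollapse g δ (boundaryPoint g s, τ) =
      boundaryPoint g (n + δ + σ τ * (s - (n + δ))) := by
  obtain ⟨m, hm, hn⟩ := sectorIndex_boundaryPoint hg hs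
  rw [sectorCollapse]
  simp only [radius_boundaryPoint, hm, hn, symm_one, mul_zero, symm_zero, polarPoint_one]
  refine .trans ?_ (boundaryPoint_add_mul_int hg _ m)
  congr 1
  push_cast
  ring

theorem continuousOn_sectorCollapse (δ : ℝ) :
    ContinuousOn (sectorCollapse g δ) (sectors g δ ×ˢ Set.univ) := by
  rintro ⟨z, τ⟩ ⟨hz, -⟩
  apply ContinuousAt.continuousWithinAt
  have h1 : ContinuousAt (fun p : Metric.closedBall (0 : ℂ) 1 × I =>
      angularPosition g δ p.1) (z, τ) :=
    ContinuousAt.comp (f := fun p : Metric.closedBall (0 : ℂ) 1 × I => (p.1 : ℂ))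
      (g := angularPosition g δ) (continuousAt_angularPosition hz) (by fun_prop)
  have h2 := continuous_radius
  refine ContinuousAt.congr (f := fun p => polarPoint g (σ (σ p.2 * σ (radius p.1)))
    (sectorIndex g δ z + δ + σ p.2 * (angularPosition g δ p.1 - (sectorIndex g δ z + δ)))) ?_ ?_
  · refine continuous_polarPoint.continuousAt.comp (f := fun p => (_, _))
      (ContinuousAt.prodMk (by fun_prop) (by fun_prop))
  · have := (continuousAt_fst (p := (z, τ))).eventually (eventually_sectorIndex_eq hz)
    filter_upwards [this] with p hp
    rw [sectorCollapse, hp.2]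

instance : SimplyConnectedSpace (Metric.closedBall (0 : ℂ) 1) :=
  have : ContractibleSpace (Metric.closedBall (0 : ℂ) 1) :=
    (convex_closedBall (0 : ℂ) 1).contractibleSpace ⟨0, by simp⟩
  SimplyConnectedSpace.ofContractible _

/-- The position at which the arc carrying a given label starts. -/
def arcStart {g : ℕ} (e : Fin g × Bool) : ℕ := 4 * (e.1 : ℕ) + cond e.2 1 0

/-- The gluing of the arc carrying a given label. -/
def arcGluing (g : ℕ) (e : Fin g × Bool) (z z' : Metric.closedBall (0 : ℂ) 1) : Prop :=
  ∃ t : I, z = boundaryPoint g (arcStart e + t) ∧ z' = boundaryPoint g (arcStart e + 3 - t)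

theorem exists_arcGluing_iff {z z' : Metric.closedBall (0 : ℂ) 1} :
    (∃ e, arcGluing g e z z') ↔ SideGluing g z z' := by
  constructor
  · rintro ⟨⟨j, b⟩, t, rfl, rfl⟩
    cases b
    · simpa [arcStart] using SideGluing.a j t
    · convert SideGluing.b j t using 2 <;> simp [arcStart]
      ring
  · rintro (⟨j, t⟩ | ⟨j, t⟩)
    · exact ⟨(j, false), t, by simp [arcStart], by simp [arcStart]⟩
    · refine ⟨(j, true), t, by simp [arcStart], congrArg _ ?_⟩
      simp [arcStart]
      ring

/-- The quotient map from the disc to the surface. -/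
def surfaceMk (g : ℕ) : C(Metric.closedBall (0 : ℂ) 1, StandardSurface g) :=
  ⟨Quot.mk (SideGluing g), continuous_quot_mk⟩

/-- An atlas for the surface, consisting of the interior of the disc and of neighbourhoods of the
vertex and of the open edges. -/
def surfaceCharts (g : ℕ) : Option Bool → Set (Metric.closedBall (0 : ℂ) 1)
  | none => {z | ‖(z : ℂ)‖ < 1}
  | some b => sectors g (cond b (1 / 2) 0)

/-- Gluing reflects positions by `s ↦ 2 * arcStart e + 3 - s`; that `2 * δ` is an integer makes this
reflection preserve the sectors. -/
theorem exists_two_mul_eq (b : Bool) : ∃ n : ℤ, 2 * (cond b (1 / 2) 0 : ℝ) = n :=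
  ⟨cond b 1 0, by cases b <;> simp⟩

theorem isGluing_surfaceMk (hg : 0 < g) :
    IsGluing (surfaceMk g) (arcGluing g) (surfaceCharts g) where
  isQuotientMap := isQuotientMap_quot_mk
  eqvGen z z' h := by
    have := Quot.eqvGen_exact h
    exact this.mono fun _ _ => exists_arcGluing_iff.2
  eq e z z' h := Quot.sound (exists_arcGluing_iff.1 ⟨e, h⟩)
  isOpen := by
    rintro (_ | b)
    · exact isOpen_lt (by fun_prop) (by fun_prop)
    · exact isOpen_sectors _
  cover z := by
    by_cases h0 : ‖(z : ℂ)‖ < 1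
    · exact ⟨none, h0⟩
    have h1 : radius z = 1 :=
      Subtype.ext (le_antisymm (radius z).2.2 (not_lt.1 h0))
    have h2 := polarPoint_radius hg 0 z
    rw [h1, polarPoint_one] at h2
    rw [← h2]
    by_contra! h
    have h3 := h (some false)
    have h4 := h (some true)
    simp only [surfaceCharts, boundaryPoint_mem_sectors_iff hg, cond, not_forall, not_not]
      at h3 h4
    obtain ⟨m, hm⟩ := h3
    obtain ⟨n, hn⟩ := h4
    -- A boundary position missed by both charts would be a half-integer and an integer at once.
    have h5 : ((2 * m + 1 : ℤ) : ℝ) = (2 * n + 2 : ℤ) := by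
      push_cast
      linarith
    have := Int.cast_injective h5
    omega
  mem_iff := by
    rintro (_ | b) e _ _ ⟨t, rfl, rfl⟩
    · simp [surfaceCharts, norm_boundaryPoint]
    · simp only [surfaceCharts, boundaryPoint_mem_sectors_iff hg]
      obtain ⟨d, hd⟩ := exists_two_mul_eq b
      constructor
      · intro h n hn
        refine h (2 * arcStart e + 2 - n - d) ?_
        push_cast
        linarith
      · intro h n hn
        refine h (2 * arcStart e + 2 - n - d) ?_
        push_cast
        linarith

/-- A point of an arc lying in a chart is near its initial vertex, near its final vertex, or in its
interior around the midpoint. -/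
theorem exists_abs_sub_lt {b : Bool} {t : I} {o : ℤ}
    (ht : ∀ n : ℤ, (o : ℝ) + t ≠ n + cond b (1 / 2) 0 + 1 / 2) :
    (b = false ∧ |(t : ℝ)| < 1 / 2) ∨ (b = false ∧ |(t : ℝ) - 1| < 1 / 2) ∨
      (b = true ∧ |(t : ℝ) - 1 / 2| < 1 / 2) := by
  have h0 := t.2.1
  have h1 := t.2.2
  cases b
  · have h2 := ht o
    simp only [cond] at h2
    rcases lt_or_ge (t : ℝ) (1 / 2) with h | h
    · exact Or.inl ⟨rfl, abs_lt.2 ⟨by linarith, h⟩⟩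
    · have h3 : (1 / 2 : ℝ) < t := lt_of_le_of_ne h fun h' => h2 (by linarith)
      exact Or.inr (Or.inl ⟨rfl, abs_lt.2 ⟨by linarith, by linarith⟩⟩)
  · have h2 := ht (o - 1)
    have h3 := ht o
    simp only [cond] at h2 h3
    push_cast at h2
    refine Or.inr (Or.inr ⟨rfl, abs_lt.2 ⟨?_, ?_⟩⟩)
    · have : (0 : ℝ) < t := lt_of_le_of_ne h0 fun h' => h2 (by linarith)
      linarith
    · have : (t : ℝ) < 1 := lt_of_le_of_ne h1 fun h' => h3 (by linarith)
      linarith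

/-- The centre of the sector lies on the closed arc and is reflected to the centre `n' + δ`. Both
points therefore slide along their arcs as mirror images and stay glued. -/
theorem sectorCollapse_compat (hg : 0 < g) {δ : ℝ} {e : Fin g × Bool} {t : I} {n n' : ℤ}
    (hn : |(arcStart e + t : ℝ) - (n + δ)| < 1 / 2) (hc0 : (arcStart e : ℝ) ≤ n + δ)
    (hc1 : (n + δ : ℝ) ≤ arcStart e + 1) (hn' : (n' + δ : ℝ) = 2 * arcStart e + 3 - (n + δ))
    (τ : I) :
    surfaceMk g (sectorCollapse g δ (boundaryPoint g (arcStart e + t), τ)) =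
      surfaceMk g (sectorCollapse g δ (boundaryPoint g (arcStart e + 3 - t), τ)) := by
  have h1 : |(arcStart e + 3 - t : ℝ) - (n' + δ)| < 1 / 2 := by
    rw [hn', abs_sub_comm]
    convert hn using 2
    ring
  rw [sectorCollapse_boundaryPoint hg hn, sectorCollapse_boundaryPoint hg h1]
  refine (isGluing_surfaceMk hg).eq e _ _
    ⟨⟨n + δ - arcStart e + σ τ * (arcStart e + t - (n + δ)), ?_⟩, ?_, ?_⟩
  · have h2 := (σ τ).2.1
    have h3 := (σ τ).2.2
    have h4 := t.2.1
    have h5 := t.2.2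
    rw [show (n + δ - arcStart e + σ τ * (arcStart e + t - (n + δ)) : ℝ) =
      (1 - σ τ) * (n + δ - arcStart e) + σ τ * t by ring]
    constructor
    · exact add_nonneg (mul_nonneg (by linarith) (by linarith)) (mul_nonneg h2 h4)
    · calc _ ≤ (1 - σ τ : ℝ) * 1 + σ τ * 1 := add_le_add
            (mul_le_mul_of_nonneg_left (by linarith) (by linarith))
            (mul_le_mul_of_nonneg_left h5 h2)
        _ = 1 := by ring
  · congr 1
    ring
  · rw [hn']
    congr 1
    ring

theorem isCollapse_sectorCollapse (hg : 0 < g) (b : Bool) :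
    IsCollapse (surfaceMk g) (arcGluing g) (surfaceCharts g (some b))
      (sectorCollapse g (cond b (1 / 2) 0)) where
  continuousOn := continuousOn_sectorCollapse _
  zero z _ := by
    rw [sectorCollapse]
    refine .trans ?_ (polarPoint_radius hg (cond b (1 / 2) 0) z)
    simp
  compat := by
    rintro e _ _ τ ⟨t, rfl, rfl⟩ hz
    have hz' := (boundaryPoint_mem_sectors_iff hg).1 hz
    rcases exists_abs_sub_lt (o := arcStart e) (by simpa using hz') with
      ⟨rfl, h⟩ | ⟨rfl, h⟩ | ⟨rfl, h⟩
    · refine sectorCollapse_compat hg (n := arcStart e) (n' := arcStart e + 3) ?_ ?_ ?_ ?_ τ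
      · simpa using h
      all_goals simp
      all_goals linarith
    · refine sectorCollapse_compat hg (n := arcStart e + 1) (n' := arcStart e + 2) ?_ ?_ ?_ ?_ τ
      · simpa using h
      all_goals simp
      all_goals linarith
    · refine sectorCollapse_compat hg (n := arcStart e) (n' := arcStart e + 2) ?_ ?_ ?_ ?_ τ
      · convert h using 2
        simp
      all_goals simp
      all_goals linarith
  one z hz := by
    filter_upwards [eventually_sectorIndex_eq hz] with w hw
    simp only [sectorCollapse, hw.2, symm_one, zero_mul, symm_zero, Set.Icc.coe_zero]

theorem exists_isCollapse (hg : 0 < g) (i : Option Bool) : ∃ C,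
    IsCollapse (surfaceMk g) (arcGluing g) (surfaceCharts g i) C := by
  rcases i with _ | b
  · refine ⟨fun p => ⟨((σ p.2 : ℝ) : ℂ) * p.1, ?_⟩, ?_, ?_, ?_, ?_⟩
    · rw [mem_closedBall_zero_iff, norm_mul, Complex.norm_real, Real.norm_of_nonneg (σ p.2).2.1]
      exact mul_le_one₀ (σ p.2).2.2 (norm_nonneg _) (mem_closedBall_zero_iff.1 p.1.2)
    · fun_prop
    · simp
    · rintro e _ _ τ ⟨t, rfl, rfl⟩ hz
      simp [surfaceCharts, norm_boundaryPoint] at hz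
    · simp
  · exact ⟨_, isCollapse_sectorCollapse hg b⟩

end SurfaceCharts

/-! ### The cocycle with values in the surface group. -/

section SurfaceCocycle

open unitInterval Topology

variable {Γ : Type*} [Group Γ] {g : ℕ}

/-- The value at the `n`-th vertex of the polygon of a cochain on the developed polygon. -/
def vertexValue (a b : ℕ → Γ) (n : ℕ) : Γ :=
  commProd a b (n / 4) * match n % 4 with
    | 0 => 1
    | 1 => a (n / 4) * b (n / 4) * (a (n / 4))⁻¹
    | 2 => a (n / 4) * b (n / 4)
    | _ => a (n / 4)

/-- The value on the `n`-th edge of the polygon of a cochain on the developed polygon. -/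
def edgeValue (a b : ℕ → Γ) (n : ℕ) : Γ :=
  match n % 4 with
    | 0 => 1
    | 1 => 1
    | 2 => a (n / 4)
    | _ => (b (n / 4))⁻¹

/-- The group element by which the cochains change under the gluing of an arc. -/
def arcValue (a b : ℕ → Γ) (e : Fin g × Bool) : Γ :=
  cond e.2 (b e.1)⁻¹ (a e.1)

theorem vertexValue_arcStart_add_three (a b : ℕ → Γ) (e : Fin g × Bool) :
    vertexValue a b (arcStart e + 3) = vertexValue a b (arcStart e) * arcValue a b e := by
  obtain ⟨j, _ | _⟩ := e
  · simp [vertexValue, arcStart, arcValue, Nat.mul_add_div]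
  · simp [vertexValue, arcStart, arcValue, Nat.mul_add_div, add_assoc, commProd,
      mul_assoc]

theorem vertexValue_arcStart_add_two (a b : ℕ → Γ) (e : Fin g × Bool) :
    vertexValue a b (arcStart e + 2) = vertexValue a b (arcStart e + 1) * arcValue a b e := by
  obtain ⟨j, _ | _⟩ := e <;>
  simp [vertexValue, arcStart, arcValue, Nat.mul_add_div, add_assoc, mul_assoc]

theorem edgeValue_arcStart_add_two (a b : ℕ → Γ) (e : Fin g × Bool) :
    edgeValue a b (arcStart e + 2) = edgeValue a b (arcStart e) * arcValue a b e := by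
  obtain ⟨j, _ | _⟩ := e <;>
  simp [edgeValue, arcStart, arcValue, Nat.mul_add_div, add_assoc]

/-- The surface relation enters here: the values at vertices `0` and `4 * g`, the same point of the
disc, must agree. -/
theorem vertexValue_mod {a b : ℕ → Γ} (hab : commProd a b g = 1) {n : ℕ} (hn : n ≤ 4 * g) :
    vertexValue a b (n % (4 * g)) = vertexValue a b n := by
  rcases hn.lt_or_eq with h | rfl
  · rw [Nat.mod_eq_of_lt h]
  · simp [vertexValue, hab, commProd]

/-- The cochains in the charts of the surface. -/
noncomputable def surfaceCochain (g : ℕ) (a b : ℕ → Γ) (i : Option Bool)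
    (z : Metric.closedBall (0 : ℂ) 1) : Γ :=
  match i with
  | none => 1
  | some false => vertexValue a b (sectorIndex g 0 z % ((4 * g : ℕ) : ℤ)).toNat
  | some true => edgeValue a b (sectorIndex g (1 / 2) z % ((4 * g : ℕ) : ℤ)).toNat

theorem arcStart_add_three_le (e : Fin g × Bool) : arcStart e + 3 ≤ 4 * g := by
  obtain ⟨j, _ | _⟩ := e <;> simp [arcStart] <;> omega

theorem continuousOn_surfaceCochain [TopologicalSpace Γ] (a b : ℕ → Γ) (i : Option Bool) :
    ContinuousOn (surfaceCochain g a b i) (surfaceCharts g i) := by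
  rcases i with _ | _ | _
  · exact continuousOn_const
  · intro z hz
    refine ((continuousAt_const (y := surfaceCochain g a b (some false) z)).congr
      ((eventually_sectorIndex_eq hz).mono fun w hw => ?_)).continuousWithinAt
    exact congrArg (fun k : ℤ => vertexValue a b (k % ((4 * g : ℕ) : ℤ)).toNat) hw.2.symm
  · intro z hz
    refine ((continuousAt_const (y := surfaceCochain g a b (some true) z)).congr
      ((eventually_sectorIndex_eq hz).mono fun w hw => ?_)).continuousWithinAt
    exact congrArg (fun k : ℤ => edgeValue a b (k % ((4 * g : ℕ) : ℤ)).toNat) hw.2.symm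

theorem toNat_sectorIndex_boundaryPoint (hg : 0 < g) {δ s : ℝ} {n : ℕ}
    (hs : |s - (n + δ)| < 1 / 2) :
    (sectorIndex g δ (boundaryPoint g s) % ((4 * g : ℕ) : ℤ)).toNat = n % (4 * g) := by
  obtain ⟨m, -, hm⟩ := sectorIndex_boundaryPoint (n := n) hg (by simpa using hs)
  rw [hm, show (4 : ℤ) * g = ((4 * g : ℕ) : ℤ) by push_cast; rfl, Int.add_mul_emod_self_left]
  norm_cast

theorem surfaceCochain_of_arcGluing (hg : 0 < g) {a b : ℕ → Γ} (hab : commProd a b g = 1)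
    (i : Option Bool) (e : Fin g × Bool) (z z' : Metric.closedBall (0 : ℂ) 1)
    (h : arcGluing g e z z') (hz : z ∈ surfaceCharts g i) :
    surfaceCochain g a b i z' = surfaceCochain g a b i z * arcValue a b e := by
  have he := arcStart_add_three_le e
  obtain ⟨t, rfl, rfl⟩ := h
  rcases i with _ | c
  · simp [surfaceCharts, norm_boundaryPoint] at hz
  have hz' := (boundaryPoint_mem_sectors_iff hg).1 hz
  rcases exists_abs_sub_lt (o := arcStart e) (by simpa using hz') with
      ⟨rfl, h⟩ | ⟨rfl, h⟩ | ⟨rfl, h⟩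
  · simp only [surfaceCochain]
    rw [toNat_sectorIndex_boundaryPoint (n := arcStart e + 3) hg (by
        rw [abs_sub_comm]; convert h using 2; push_cast; ring),
      toNat_sectorIndex_boundaryPoint (n := arcStart e) hg (by simpa using h),
      vertexValue_mod hab (by omega), vertexValue_mod hab (by omega),
      vertexValue_arcStart_add_three]
  · simp only [surfaceCochain]
    rw [toNat_sectorIndex_boundaryPoint (n := arcStart e + 2) hg (by
        rw [abs_sub_comm]; convert h using 2; push_cast; ring),
      toNat_sectorIndex_boundaryPoint (n := arcStart e + 1) hg (by simpa using h),
      vertexValue_mod hab (by omega), vertexValue_mod hab (by omega),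
      vertexValue_arcStart_add_two]
  · simp only [surfaceCochain]
    rw [toNat_sectorIndex_boundaryPoint (n := arcStart e + 2) hg (by
        rw [abs_sub_comm]; convert h using 2; push_cast; ring),
      toNat_sectorIndex_boundaryPoint (n := arcStart e) hg (by convert h using 2; ring),
      Nat.mod_eq_of_lt (by omega), Nat.mod_eq_of_lt (by omega), edgeValue_arcStart_add_two]

end SurfaceCocycle

/-! ### The fundamental group of the standard surface and the conclusion. -/

section SurfaceFundamentalGroup

open CategoryTheory unitInterval Topology

variable {g : ℕ}

theorem arcGluing_zero (e : Fin g × Bool) :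
    arcGluing g e (boundaryPoint g (arcStart e : ℕ)) (boundaryPoint g (arcStart e + 3 : ℕ)) :=
  ⟨0, by simp, by simp⟩

theorem arcGluing_one (e : Fin g × Bool) :
    arcGluing g e (boundaryPoint g (arcStart e + 1 : ℕ))
      (boundaryPoint g (arcStart e + 2 : ℕ)) :=
  ⟨1, by simp, by simp; congr 1; ring⟩

/-- Gluing the ends of the arcs links the vertices `4 * j`, `4 * j + 3`, `4 * j + 2`, `4 * j + 1`,
`4 * j + 4` in this order. -/
theorem surfaceMk_vertex (hg : 0 < g) (k : ℕ) :
    surfaceMk g (boundaryPoint g k) = surfaceMk g (boundaryPoint g (0 : ℕ)) := by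
  have h0 (e : Fin g × Bool) := (isGluing_surfaceMk hg).eq e _ _ (arcGluing_zero e)
  have h1 (e : Fin g × Bool) := (isGluing_surfaceMk hg).eq e _ _ (arcGluing_one e)
  simp only [arcStart] at h0 h1
  have h (j : ℕ) (hj : j ≤ g) : surfaceMk g (boundaryPoint g (4 * j : ℕ)) =
      surfaceMk g (boundaryPoint g (0 : ℕ)) := by
    induction j with
    | zero => rfl
    | succ j ih =>
      have ha0 := h0 (⟨j, hj⟩, false)
      have ha1 := h1 (⟨j, hj⟩, false)
      have hb0 := h0 (⟨j, hj⟩, true)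
      have hb1 := h1 (⟨j, hj⟩, true)
      simp only [cond, add_zero, add_assoc, Nat.reduceAdd] at ha0 ha1 hb0 hb1
      rw [← ih (by omega), ha0, ← hb1, ← ha1, hb0]
      rfl
  obtain ⟨n, m, hlt, rfl⟩ : ∃ n m, n < 4 * g ∧ k = n + 4 * g * m :=
    ⟨k % (4 * g), k / (4 * g), Nat.mod_lt _ (by omega), (Nat.mod_add_div _ _).symm⟩
  rw [show boundaryPoint g (n + 4 * g * m : ℕ) = boundaryPoint g n from
    (boundaryPoint_eq_iff hg).2 ⟨m, by push_cast; rfl⟩]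
  have hj : n / 4 < g := by omega
  have ha0 := h0 (⟨n / 4, hj⟩, false)
  have ha1 := h1 (⟨n / 4, hj⟩, false)
  have hb1 := h1 (⟨n / 4, hj⟩, true)
  simp only [cond, add_zero, add_assoc, Nat.reduceAdd] at ha0 ha1 hb1
  have hn : n = 4 * (n / 4) ∨ n = 4 * (n / 4) + 1 ∨ n = 4 * (n / 4) + 2 ∨ n = 4 * (n / 4) + 3 := by
    omega
  rw [← h (n / 4) hj.le]
  rcases hn with hn | hn | hn | hn
  · rw [← hn]
  · nth_rewrite 1 [hn]
    rw [ha0, ha1, hb1]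
  · nth_rewrite 1 [hn]
    rw [ha0, hb1]
  · nth_rewrite 1 [hn]
    rw [ha0]

/-- The loop given by the segment from the first vertex to the `k`-th vertex. -/
noncomputable def vertexLoop (hg : 0 < g) (k : ℕ) :
    FundamentalGroup (StandardSurface g) (surfaceMk g (boundaryPoint g (0 : ℕ))) :=
  gluingLoop (surfaceMk g) _ (surfaceMk_vertex hg k)

/-- The class of the loops obtained by crossing an arc of the polygon. -/
noncomputable def arcLoop (hg : 0 < g) (e : Fin g × Bool) :
    FundamentalGroup (StandardSurface g) (surfaceMk g (boundaryPoint g (0 : ℕ))) :=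
  gluingLoop (surfaceMk g) _ ((isGluing_surfaceMk hg).eq e _ _ (arcGluing_zero e))

theorem gluingLoop_eq_arcLoop (hg : 0 < g) {e : Fin g × Bool} {z z' : Metric.closedBall (0 : ℂ) 1}
    (h : arcGluing g e z z') (hz : surfaceMk g z = surfaceMk g z') :
    gluingLoop (surfaceMk g) _ hz = arcLoop hg e := by
  have hb := continuous_boundaryPoint g
  obtain ⟨t, rfl, rfl⟩ := h
  symm
  refine gluingLoop_eq_of_path (q := surfaceMk g) _
    { toFun := fun s => boundaryPoint g (arcStart e + (s * t : I))
      source' := by simp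
      target' := by simp }
    { toFun := fun s => boundaryPoint g (arcStart e + 3 - (s * t : I))
      source' := by simp
      target' := by simp } (fun s => ?_) _ _
  exact (isGluing_surfaceMk hg).eq e _ _ ⟨s * t, rfl, rfl⟩

theorem gluingLoop_vertices (hg : 0 < g) (k l : ℕ)
    (h : surfaceMk g (boundaryPoint g k) = surfaceMk g (boundaryPoint g l)) :
    gluingLoop (surfaceMk g) _ h = (vertexLoop hg l)⁻¹ * vertexLoop hg k := by
  rw [vertexLoop, vertexLoop, ← gluingLoop_symm, ← gluingLoop_trans]

theorem arcLoop_eq_zero (hg : 0 < g) (e : Fin g × Bool) :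
    arcLoop hg e = (vertexLoop hg (arcStart e + 3))⁻¹ * vertexLoop hg (arcStart e) :=
  gluingLoop_vertices hg _ _ _

theorem arcLoop_eq_one (hg : 0 < g) (e : Fin g × Bool) :
    arcLoop hg e = (vertexLoop hg (arcStart e + 2))⁻¹ * vertexLoop hg (arcStart e + 1) := by
  rw [← gluingLoop_eq_arcLoop hg (arcGluing_one e)
    ((isGluing_surfaceMk hg).eq e _ _ (arcGluing_one e))]
  exact gluingLoop_vertices hg _ _ _

theorem vertexLoop_zero (hg : 0 < g) : vertexLoop hg 0 = 1 := by
  rw [vertexLoop, gluingLoop]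
  simp

theorem vertexLoop_last (hg : 0 < g) : vertexLoop hg (4 * g) = 1 := by
  have h : boundaryPoint g (4 * g : ℕ) = boundaryPoint g (0 : ℕ) :=
    (boundaryPoint_eq_iff hg).2 ⟨1, by push_cast; ring⟩
  have key (z z₀ : Metric.closedBall (0 : ℂ) 1) (hz : z = z₀) (h : surfaceMk g z = surfaceMk g z₀) :
      gluingLoop (surfaceMk g) z₀ h = 1 := by
    subst hz
    rw [gluingLoop]
    simp
  exact key _ _ h _

/-- Each arc loop is a quotient of vertex loops in two ways, one for each end of the arc. With the
suitable choice for each of the four factors of a commutator, the product telescopes to `vertexLoop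
hg (4 * j)`. -/
theorem commProd_arcLoop (hg : 0 < g) :
    commProd (extendOne fun j : Fin g => (arcLoop hg (j, false))⁻¹)
      (extendOne fun j : Fin g => arcLoop hg (j, true)) g = 1 := by
  have key (j : ℕ) (hj : j ≤ g) : commProd (extendOne fun j : Fin g => (arcLoop hg (j, false))⁻¹)
      (extendOne fun j : Fin g => arcLoop hg (j, true)) j = vertexLoop hg (4 * j) := by
    induction j with
    | zero => exact (vertexLoop_zero hg).symm
    | succ j ih =>
      have hj' : j < g := hj
      have ha0 := arcLoop_eq_zero hg (⟨j, hj⟩, false)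
      have ha1 := arcLoop_eq_one hg (⟨j, hj⟩, false)
      have hb0 := arcLoop_eq_zero hg (⟨j, hj⟩, true)
      have hb1 := arcLoop_eq_one hg (⟨j, hj⟩, true)
      simp only [arcStart, cond, add_zero, add_assoc, Nat.reduceAdd] at ha0 ha1 hb0 hb1
      rw [commProd, ih (by omega)]
      simp only [extendOne, hj', dif_pos]
      nth_rewrite 1 [ha0]
      nth_rewrite 1 [hb1]
      rw [ha1, hb0, Nat.mul_add, mul_one]
      group
  rw [key g le_rfl, vertexLoop_last]

/-- The homomorphism from the surface group to the fundamental group of the surface. -/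
noncomputable def surfaceGroupHom (hg : 0 < g) : SurfaceGroup g →*
    FundamentalGroup (StandardSurface g) (surfaceMk g (boundaryPoint g (0 : ℕ))) :=
  SurfaceGroup.lift _ _ (commProd_arcLoop hg)

theorem surfaceGroupHom_a (hg : 0 < g) (j : Fin g) :
    surfaceGroupHom hg (SurfaceGroup.a g j) = (arcLoop hg (j, false))⁻¹ := by
  rw [surfaceGroupHom, SurfaceGroup.lift_a _ _ _ j.2]
  simp [extendOne]

theorem surfaceGroupHom_b (hg : 0 < g) (j : Fin g) :
    surfaceGroupHom hg (SurfaceGroup.b g j) = arcLoop hg (j, true) := by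
  rw [surfaceGroupHom, SurfaceGroup.lift_b _ _ _ j.2]
  simp [extendOne]

theorem surfaceGroupHom_surjective (hg : 0 < g) : Function.Surjective (surfaceGroupHom hg) := by
  rw [← MonoidHom.range_eq_top]
  refine (isGluing_surfaceMk hg).eq_top_of_forall_gluingLoop_mem ?_ (exists_isCollapse hg)
  intro e z z' he hz
  rw [gluingLoop_eq_arcLoop hg he hz]
  obtain ⟨j, _ | _⟩ := e
  · rw [← Subgroup.inv_mem_iff, ← surfaceGroupHom_a]
    exact ⟨_, rfl⟩
  · rw [← surfaceGroupHom_b]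
    exact ⟨_, rfl⟩

/-- The monodromy of the covering turns the image of `w` into left translation by `w` on the copy
`Λ` of the surface group in the fibre. -/
theorem surfaceGroupHom_injective (hg : 0 < g) : Function.Injective (surfaceGroupHom hg) := by
  let _ : TopologicalSpace (SurfaceGroup g) := ⊥
  have _ : DiscreteTopology (SurfaceGroup g) := ⟨rfl⟩
  obtain ⟨Ω, M, Λ, hΛ, hM⟩ := (isGluing_surfaceMk hg).exists_monodromy
    (fun i => continuousOn_surfaceCochain (SurfaceGroup.a g) (SurfaceGroup.b g) i)
    (surfaceCochain_of_arcGluing hg (SurfaceGroup.commProd_eq_one g)) (boundaryPoint g (0 : ℕ))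
  have hM' (e : Fin g × Bool) (k : SurfaceGroup g) : M (arcLoop hg e) (Λ k) =
      Λ ((arcValue (SurfaceGroup.a g) (SurfaceGroup.b g) e)⁻¹ * k) :=
    hM e _ _ (arcGluing_zero e) _ k
  have key (w : SurfaceGroup g) : ∀ k, M (surfaceGroupHom hg w) (Λ k) = Λ (w * k) := by
    have hw : w ∈ Subgroup.closure {z | ∃ k < g, z = SurfaceGroup.a g k ∨ z = SurfaceGroup.b g k} :=
      SurfaceGroup.closure_generators g ▸ Subgroup.mem_top w
    induction hw using Subgroup.closure_induction with
    | mem w hw =>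
      intro k
      obtain ⟨j, hj, rfl | rfl⟩ := hw
      · rw [surfaceGroupHom_a hg ⟨j, hj⟩, map_inv, Equiv.Perm.inv_eq_iff_eq, hM']
        simp [arcValue]
      · rw [surfaceGroupHom_b hg ⟨j, hj⟩, hM']
        simp [arcValue]
    | one =>
      intro k
      rw [map_one, map_one, one_mul, Equiv.Perm.one_apply]
    | mul v w _ _ ihv ihw =>
      intro k
      rw [map_mul, map_mul, Equiv.Perm.mul_apply, ihw, ihv, mul_assoc]
    | inv w _ ih =>
      intro k
      rw [map_inv, map_inv, Equiv.Perm.inv_eq_iff_eq, ih, mul_inv_cancel_left]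
  rw [injective_iff_map_eq_one]
  intro w hw
  have := key w 1
  rw [hw, map_one, Equiv.Perm.one_apply, mul_one] at this
  exact (hΛ this).symm

instance : PathConnectedSpace (StandardSurface g) :=
  (Quot.mk_surjective (r := SideGluing g)).pathConnectedSpace continuous_quot_mk

/-- The fundamental group of the standard surface is the surface group. -/
noncomputable def fundamentalGroupStandardSurface (hg : 0 < g) (x : StandardSurface g) :
    FundamentalGroup (StandardSurface g) x ≃* SurfaceGroup g :=
  (FundamentalGroup.fundamentalGroupMulEquivOfPathConnected _ _).trans
    (MulEquiv.ofBijective (surfaceGroupHom hg)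
      ⟨surfaceGroupHom_injective hg, surfaceGroupHom_surjective hg⟩).symm

theorem map_injective_of_homeomorph {X Y : Type*} [TopologicalSpace X] [TopologicalSpace Y]
    (e : X ≃ₜ Y) (x : X) : Function.Injective (FundamentalGroup.map (e : C(X, Y)) x) := by
  intro p p' h
  obtain ⟨P, rfl⟩ := Path.Homotopic.Quotient.mk_surjective p
  obtain ⟨P', rfl⟩ := Path.Homotopic.Quotient.mk_surjective p'
  obtain ⟨F⟩ := Path.Homotopic.Quotient.eq.1
    (h : Path.Homotopic.Quotient.mk (P.map e.continuous) =
      Path.Homotopic.Quotient.mk (P'.map e.continuous))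
  refine Path.Homotopic.Quotient.eq.2 ⟨⟨⟨⟨fun a => e.symm (F a), by fun_prop⟩, ?_, ?_⟩, ?_⟩⟩
  · intro a
    simp
  · intro a
    simp
  · intro t a ha
    exact e.symm_apply_eq.2 (F.eq_fst t ha)

end SurfaceFundamentalGroup

theorem mainTheorem2 (p : ℕ) [Fact p.Prime] (hp : 5 ≤ p) (g : ℕ) (hg : 2 ≤ g)
    (X : Type*) [TopologicalSpace X] (hX : IsClosedSurfaceOfGenus g X) (x : X)
    (K : Type*) [Field K] [CharP K p] [Algebra (ZMod p) K]
    (hK : 2 ≤ Algebra.trdeg (ZMod p) K) :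
    ∃ (n : ℕ) (H : Subgroup (GL (Fin n) K)), Nonempty (H ≃* FundamentalGroup X x) := by
  obtain ⟨e⟩ := hX
  obtain ⟨R, hR⟩ := exists_surfaceGroup_injective_GL p (by omega) hg K hK
  let f : FundamentalGroup X x →* GL (Fin 2) K := R.comp
    ((fundamentalGroupStandardSurface (g := g) (by omega) (e x)).toMonoidHom.comp
      (FundamentalGroup.map (e : C(X, StandardSurface g)) x))
  have hf : Function.Injective f := hR.comp
    ((fundamentalGroupStandardSurface (by omega) (e x)).injective.comp
      (map_injective_of_homeomorph e x))
  exact ⟨2, f.range, ⟨(MonoidHom.ofInjective hf).symm⟩⟩
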